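/- Consider a finite-horizon episodic MDP with finite state space $\mathcal S$ ($|\mathcal S|=S$), finite non-empty action space $\mathcal A$ ($|\mathcal A|=A$), horizon $H\ge 1$, initial state $s_{\mathrm{init}}$ and transition function $p$ known to the learner, $p_h(\cdot\mid s,a)$ for $h\in[H]$. A policy is $\pi=(\pi_h(\cdot\mid s))_{h,s}$; its occupancy measure $q^\pi_h(s,a)$ is the probability to visit $s$ at step $h$ and take action $a$; $\Delta(\mathcal M)$ is the set of all occupancy measures; $V^{\pi}(c)$ is the expected cost $\mathbb E^{\pi}[\sum_{h=1}^H c_h(s_h,a_h)]$ of an episode started in $s_{\mathrm{init}}$. An oblivious adversary fixes cost functions $c^1,\dots,c^K$ with values $c^k_h(s,a)\in[0,1]$ and delays $d^1,\dots,d^K\in\mathbb N$, $K\ge1$; the costs $c^k_h(s^k_h,a^k_h)$, $h\in[H]$, along the trajectory of episode $k$ are revealed at the end of episode $k+d^k$. Put $D=\sum_{k=1}^K d^k$, $d_{max}=\max_k d^k$, and assume $d_{max}\le\sqrt D$. Let $\delta\in(0,1)$. Delayed O-REPS with the delay-adapted estimator and parameters $\eta,\gamma$ starts from $q^1_h(s,a)=\frac1{SA}$.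 In each episode $k=1,\dots,K$ it plays the policy $\pi^k_h(a\mid s)=q^k_h(s,a)/\sum_{a'}q^k_h(s,a')$ (uniform where the denominator is $0$); at the end of the episode it forms, for every $j$ with $j+d^j=k$, $$\hat c^j_h(s,a)=\frac{c^j_h(s,a)\,\mathbb 1\{s^j_h=s,a^j_h=a\}}{\max\{q^j_h(s,a),q^{k}_h(s,a)\}+\gamma},$$ and updates $$q^{k+1}=\arg\min_{q\in\Delta(\mathcal M)}\ \eta\Big\langle q,\sum_{j:j+d^j=k}\hat c^j\Big\rangle+\mathrm{KL}(q\,\|\,q^k),\qquad \mathrm{KL}(q\,\|\,q')=\sum_{h,s,a}\Big(q_h(s,a)\ln\tfrac{q_h(s,a)}{q'_h(s,a)}+q'_h(s,a)-q_h(s,a)\Big).$$ Run it with $\eta=\gamma=\min\Big\{\sqrt{\tfrac{\log(HSA/\delta)}{SAK}},\sqrt{\tfrac{\log(HSA/\delta)}{\sqrt{HSA}\,D}}\Big\}$ (the second term being $+\infty$ if $D=0$). Then there is an absolute constant $C>0$ (independent of the MDP, the costs, the delays, $K$ and $\delta$) such that, with probability at least $1-\delta$, the regret $R_K=\sum_{k=1}^K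 V^{\pi^k}(c^k)-\min_\pi\sum_{k=1}^K V^{\pi}(c^k)$ satisfies $$R_K\le C\Big(H\sqrt{SAK\log\tfrac{HSA}{\delta}}+(HSA)^{1/4}H\sqrt{D\log\tfrac{HSA}{\delta}}+H^{3/2}d_{max}\log\tfrac H\delta\Big).$$ -/

import Mathlib

namespace DelayedOREPS

/-- A finite-horizon episodic MDP (without costs): the initial state and, for every step `h`, the
transition probabilities `p_h(· ∣ s, a)`. Steps are indexed by `Fin H`, i.e. `0, …, H - 1`. -/
structure MDP (S A : Type*) (H : ℕ) where
  init : S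
  p : Fin H → S → A → PMF S

/-- A stochastic Markov policy, `π_h(· ∣ s)`. -/
abbrev Policy (S A : Type*) (H : ℕ) := Fin H → S → PMF A

/-- A trajectory `(s_h, a_h)_h` of one episode. -/
abbrev Traj (S A : Type*) (H : ℕ) := Fin H → S × A

/-- Real functions of `(h, s, a)`: cost functions, cost estimators, occupancy measures. -/
abbrev Table (S A : Type*) (H : ℕ) := Fin H → S → A → ℝ

noncomputable section

variable {S A : Type*} {H : ℕ}

/-- The law of the first `n` state-action pairs and of the state reached after them: in the current
state `s` an action `a ∼ π_h(· ∣ s)` is drawn, then the next state `s' ∼ p_h(· ∣ s, a)`. -/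
def rollout (M : MDP S A H) (π : Policy S A H) :
    (n : ℕ) → n ≤ H → PMF ((Fin n → S × A) × S)
  | 0, _ => PMF.pure (Fin.elim0, M.init)
  | n + 1, hn =>
      (rollout M π n (Nat.le_of_succ_le hn)).bind fun x =>
        (π ⟨n, hn⟩ x.2).bind fun a =>
          (M.p ⟨n, hn⟩ x.2 a).map fun s' =>
            (Fin.snoc (α := fun _ => S × A) x.1 (x.2, a), s')

/-- The law of the trajectory of one episode played with the policy `π`. -/
def episode (M : MDP S A H) (π : Policy S A H) : PMF (Traj S A H) :=
  (rollout M π H le_rfl).map Prod.fst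

/-- The occupancy measure `q^π_h(s, a)`: the probability to visit `s` at step `h` and to take the
action `a` there. -/
def occupancy (M : MDP S A H) (π : Policy S A H) : Table S A H := fun h s a =>
  ((episode M π).toOuterMeasure {τ | τ h = (s, a)}).toReal

/-- The set `Δ(M)` of all occupancy measures of the MDP. -/
def occSet (M : MDP S A H) : Set (Table S A H) := Set.range (occupancy M)

variable [Fintype S] [Fintype A]

/-- The value `V^π_1(s_init; c)`: the expected cost of `π` in one episode. -/
def value (M : MDP S A H) (π : Policy S A H) (c : Table S A H) : ℝ :=
  ∑ τ : Fin H → S × A, (episode M π τ).toReal * ∑ h, c h (τ h).1 (τ h).2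

/-- The pairing `⟨q, c⟩ = ∑_{h,s,a} q_h(s,a) c_h(s,a)`. -/
def pairing (q c : Table S A H) : ℝ := ∑ h, ∑ s, ∑ a, q h s a * c h s a

/-- The unnormalized Kullback-Leibler divergence `KL(q ‖ q')`. All members of `Δ(M)` vanish at the
unreachable `(h, s, a)`, and every iterate of the algorithm is positive at the reachable ones, so
along the algorithm the argument of the logarithm is never `x / 0` with `x ≠ 0`
(and `0 * log (0 / 0) = 0`). -/
def KL (q q' : Table S A H) : ℝ :=
  ∑ h, ∑ s, ∑ a, (q h s a * Real.log (q h s a / q' h s a) + q' h s a - q h s a)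

/-- The online mirror descent step `argmin_{q' ∈ Δ(M)} η ⟨q', L⟩ + KL(q' ‖ q)`. The objective is
continuous and `Δ(M)` is compact, so that a minimizer exists. -/
def omdStep (M : MDP S A H) (η : ℝ) (q L : Table S A H) : Table S A H :=
  Classical.epsilon fun q₁ =>
    q₁ ∈ occSet M ∧ IsMinOn (fun q' => η * pairing q' L + KL q' q) (occSet M) q₁

open Classical in
/-- The delay-adapted cost estimator of an episode with cost function `c` and trajectory `τ`, where
`q` is the iterate of that episode and `qa` the one of the episode at whose end the feedback
arrives. -/
def estimator (γ : ℝ) (q qa c : Table S A H) (τ : Traj S A H) : Table S A H := fun h s a =>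
  c h s a * (if τ h = (s, a) then 1 else 0) / (max (q h s a) (qa h s a) + γ)

/-- The iterates `q^k` of the algorithm as a function of the trajectories `ω` of the episodes played
so far. Episodes are numbered from `0`; the feedback of episode `j` arrives at the end of episode
`j + d j`. For `k ≤ n` the iterate `q^k` depends on `ω` only through the episodes `j` with
`j + d j < k`. -/
def iterate (M : MDP S A H) (c : ℕ → Table S A H) (d : ℕ → ℕ) (η γ : ℝ) {n : ℕ}
    (ω : Fin n → Traj S A H) : ℕ → Table S A H
  | 0 => fun _ _ _ => 1 / ((Fintype.card S : ℝ) * Fintype.card A)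
  | k + 1 =>
      omdStep M η (iterate M c d η γ ω k)
        (∑ j : Fin n, if _h : (j : ℕ) + d j = k then
          estimator γ (iterate M c d η γ ω j) (iterate M c d η γ ω k) (c j) (ω j) else 0)
termination_by k => k
decreasing_by all_goals omega

/-- The policy `π_h(a ∣ s) = q_h(s,a) / ∑_{a'} q_h(s,a')`; at the pairs `(h, s)` with
`∑_{a'} q_h(s,a') = 0`, where the quotient is undefined, the uniform distribution is taken. -/
def policyOf [Nonempty A] (q : Table S A H) : Policy S A H := fun h s =>
  open Classical in
  if hq : ∑' a, ENNReal.ofReal (q h s a) = 0 then PMF.uniformOfFintype A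
  else PMF.normalize (fun a => ENNReal.ofReal (q h s a)) hq
    (by rw [tsum_fintype]; exact ENNReal.sum_ne_top.2 fun _ _ => ENNReal.ofReal_ne_top)

/-- The policy `π^k` played in episode `k`. -/
def policy [Nonempty A] (M : MDP S A H) (c : ℕ → Table S A H) (d : ℕ → ℕ) (η γ : ℝ) {n : ℕ}
    (ω : Fin n → Traj S A H) (k : ℕ) : Policy S A H :=
  policyOf (iterate M c d η γ ω k)

/-- The law of the trajectories of the first `n` episodes of a run of the algorithm: in episode `n`
the policy computed from the previous episodes is played. -/
def run [Nonempty A] (M : MDP S A H) (c : ℕ → Table S A H) (d : ℕ → ℕ) (η γ : ℝ) :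
    (n : ℕ) → PMF (Fin n → Traj S A H)
  | 0 => PMF.pure Fin.elim0
  | n + 1 =>
      (run M c d η γ n).bind fun ω =>
        (episode M (policy M c d η γ ω n)).map
          (Fin.snoc (α := fun _ => Traj S A H) ω)

/-- The regret `∑_k V^{π^k}(c^k) - min_π ∑_k V^π(c^k)` of the policies `π^0, …, π^{K-1}`. -/
def regret (M : MDP S A H) (c : ℕ → Table S A H) (K : ℕ) (π : ℕ → Policy S A H) : ℝ :=
  ∑ k ∈ Finset.range K, value M (π k) (c k) -
    ⨅ π' : Policy S A H, ∑ k ∈ Finset.range K, value M π' (c k)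

/-- The total delay `D`. -/
def totalDelay (d : ℕ → ℕ) (K : ℕ) : ℕ := ∑ k ∈ Finset.range K, d k

/-- The maximal delay `d_max`. -/
def maxDelay (d : ℕ → ℕ) (K : ℕ) : ℕ := (Finset.range K).sup d

/-- The common value of `η` and `γ`,
`min {√(log(HSA/δ) / (SAK)), √(log(HSA/δ) / (√(HSA) D))}`,
where the second root is `+∞` if `D = 0`. Here `H, S, A, K, D` are the numbers. -/
def rate (H S A K D δ : ℝ) : ℝ :=
  open Classical in
  if D = 0 then √(Real.log (H * S * A / δ) / (S * A * K))
  else min (√(Real.log (H * S * A / δ) / (S * A * K)))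
    (√(Real.log (H * S * A / δ) / (√(H * S * A) * D)))

/-- The expression inside the `O(·)` of the regret bound. -/
def bound (H S A K D dmax δ : ℝ) : ℝ :=
  H * √(S * A * K * Real.log (H * S * A / δ))
    + (H * S * A) ^ (1 / 4 : ℝ) * H * √(D * Real.log (H * S * A / δ))
    + H ^ (3 / 2 : ℝ) * dmax * Real.log (H / δ)

end

end DelayedOREPS

/-! Order the episodes by the arrival of their feedback, ties broken by the index. The law of the
run is the product over `j` of the law of trajectory `j` under `π^j` (`run_apply`), and `π^j`
depends only on feedback that arrives before episode `j`. The product can therefore be summed in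
arrival order (`sum_prod_le_one`): given everything that arrives earlier, trajectory `j` still
follows `π^j`, while both `q^j` and `q^{j+d_j}` are already determined. So the denominators of the
estimators are predictable, although `q^{j+d_j}` is computed after episode `j` was played, and
exponential supermartingales are available (`run_exp_tail`).

Let `u` be the occupancy measure of a comparator and `m = k + d_k`. In `regret_decomposition` the
regret of episode `k` is split into `⟨q^k - q^m, c⟩`, the bias `⟨q^m, c - E ĉ⟩`, the noise `⟨q^m, E
ĉ - ĉ⟩`, the mirror descent regret `⟨q^m - u, ĉ⟩` and the overestimation `⟨u, ĉ - c⟩`.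

The first two cost twice the `ℓ¹` distance of `q^k` and `q^m`, plus `γHSA` (`arrival_mul_bias_le`).
The noise has range `H`, since `q^m ĉ ≤ 1` in every coordinate (`arrival_lateEst_lower_tail`). In
the mirror descent regret each estimator is paired with the very iterate that it updates, so delays
enter only through squares of sums of simultaneous arrivals (`mirror_regret`, `sum_localNorm_le`);
at most `D` pairs of estimators coincide. The overestimation is controlled by implicit exploration
in each coordinate (`lateEst_upper_tail`).

The drift is the main price of the delays. One step moves the iterate by at most `η √(2H)` times the
sum of `√‖ĉ_j‖₁` over the arrivals (`iterate_stability`), the conditional mean of `√‖ĉ_j‖₁` is at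
most `√(HSA)`, and each arrival is counted once for every outstanding episode, about `2D` times in
total. This gives order `ηH√(SA) D` (`sum_drift_le`, `sum_sqrt_lateEst_tail`).

The initial iterate need not be an occupancy measure, so episode `0` is removed from the
probabilistic part (`lateFactor`) and paid for directly. The arithmetic needs `log 2 ≤ L ≤ K` for `L
= log (HSA/δ)`. For a single action the regret is zero, and for `L > K` the trivial bound `KH`
suffices. -/

namespace DelayedOREPS

noncomputable section

/-! ### Occupancy measures as a polytope of flows. -/

section OccupancyPolytope

variable {S A : Type*} {H : ℕ}

/-- The law of the state reached after `n` steps. -/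
def stateLaw (M : MDP S A H) (π : Policy S A H) (n : ℕ) (hn : n ≤ H) : PMF S :=
  (rollout M π n hn).map Prod.snd

lemma stateLaw_zero (M : MDP S A H) (π : Policy S A H) (h : 0 ≤ H) :
    stateLaw M π 0 h = PMF.pure M.init := by
  simp [stateLaw, rollout, PMF.pure_map]

lemma stateLaw_succ (M : MDP S A H) (π : Policy S A H) (n : ℕ) (hn : n + 1 ≤ H) :
    stateLaw M π (n + 1) hn =
      (stateLaw M π n (Nat.le_of_succ_le hn)).bind fun s =>
        (π ⟨n, hn⟩ s).bind fun a => M.p ⟨n, hn⟩ s a := by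
  simp only [stateLaw, rollout, PMF.map_bind, PMF.map_comp, PMF.bind_map, Function.comp_def]
  congr 1; funext x; congr 1; funext a
  exact PMF.map_id _

/-- Later steps only append to the history, so a recorded coordinate keeps its law; for the newest
coordinate the final transition integrates out. -/
lemma rollout_map_coord (M : MDP S A H) (π : Policy S A H) (n : ℕ) (hn : n ≤ H) (i : Fin n) :
    (rollout M π n hn).map (fun x => x.1 i) =
      (stateLaw M π i (i.2.le.trans hn)).bind fun s =>
        (π ⟨i, i.2.trans_le hn⟩ s).map fun a => (s, a) := by
  induction n with
  | zero => exact i.elim0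
  | succ n ih =>
    simp only [rollout, PMF.map_bind, PMF.map_comp, Function.comp_def]
    refine Fin.lastCases ?_ (fun i => ?_) i
    · simp only [Fin.snoc_last, stateLaw, PMF.bind_map, Function.comp_def, Fin.val_last]
      congr 1; funext x
      rw [← PMF.bind_pure_comp]
      congr 1; funext a
      exact PMF.map_const _ _
    · simp only [Fin.snoc_castSucc, Fin.val_castSucc]
      rw [← ih (Nat.le_of_succ_le hn) i, ← PMF.bind_pure_comp]
      congr 1; funext x
      rw [show (fun a => PMF.map (fun _ => x.1 i) (M.p ⟨n, hn⟩ x.2 a)) =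
        fun _ => PMF.pure (x.1 i) from funext fun a => PMF.map_const _ _, PMF.bind_const]
      rfl

lemma occupancy_eq (M : MDP S A H) (π : Policy S A H) (h : Fin H) (s : S) (a : A) :
    occupancy M π h s a = (stateLaw M π h h.2.le s).toReal * (π h s a).toReal := by
  classical
  have h1 : (episode M π).toOuterMeasure {τ | τ h = (s, a)}
      = ((episode M π).map fun τ => τ h) (s, a) := by
    rw [← PMF.toOuterMeasure_apply_singleton, PMF.toOuterMeasure_map_apply]
    rfl
  rw [occupancy, h1, episode, PMF.map_comp]
  have h2 := rollout_map_coord M π H le_rfl h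
  rw [show ((fun τ : Traj S A H => τ h) ∘ Prod.fst : (Traj S A H × S) → S × A)
    = fun x => x.1 h from rfl, h2, PMF.bind_apply, ← ENNReal.toReal_mul]
  congr 1
  rw [tsum_eq_single s]
  · congr 1
    rw [PMF.map_apply, tsum_eq_single a]
    · simp
    · intro b hb; simp [Ne.symm hb]
  · intro s' hs'
    rw [PMF.map_apply]
    simp [Ne.symm hs']

/-- The product form also covers states of zero mass: the policy is uniform there, but both sides
vanish. -/
lemma mul_policyOf [Fintype A] [Nonempty A] (q : Table S A H) (hq : ∀ h s a, 0 ≤ q h s a) (h : Fin H) (s : S) (a : A) :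
    (∑ a', q h s a') * (policyOf q h s a).toReal = q h s a := by
  have hs : ∑' a, ENNReal.ofReal (q h s a) = ENNReal.ofReal (∑ a, q h s a) := by
    rw [tsum_fintype, ENNReal.ofReal_sum_of_nonneg fun a _ => hq h s a]
  by_cases h0 : ∑ a', q h s a' = 0
  · rw [h0, zero_mul]
    exact ((Finset.sum_eq_zero_iff_of_nonneg fun a _ => hq h s a).1 h0 a (Finset.mem_univ a)).symm
  · have hpos : 0 < ∑ a', q h s a' := lt_of_le_of_ne (Finset.sum_nonneg fun a _ => hq h s a)
      (Ne.symm h0)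
    have h1 : ¬ ∑' a, ENNReal.ofReal (q h s a) = 0 := by
      rw [hs, ENNReal.ofReal_eq_zero, not_le]; exact hpos
    rw [policyOf, dif_neg h1, PMF.normalize_apply, hs, ENNReal.toReal_mul, ENNReal.toReal_inv,
      ENNReal.toReal_ofReal hpos.le, ENNReal.toReal_ofReal (hq h s a)]
    field_simp

variable [Fintype S] [Fintype A]

lemma sum_toReal_pmf {α : Type*} [Fintype α] (p : PMF α) : ∑ a, (p a).toReal = 1 := by
  rw [← ENNReal.toReal_sum fun a _ => p.apply_ne_top a,
    ← tsum_fintype (L := .unconditional α), p.tsum_coe, ENNReal.toReal_one]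

lemma toReal_bind {α β : Type*} [Fintype α] (p : PMF α) (f : α → PMF β) (b : β) :
    (p.bind f b).toReal = ∑ a, (p a).toReal * (f a b).toReal := by
  rw [PMF.bind_apply, tsum_fintype, ENNReal.toReal_sum]
  · simp
  · exact fun a _ => ENNReal.mul_ne_top (p.apply_ne_top a) ((f a).apply_ne_top b)

/-- The linear constraints which describe the occupancy measures. -/
structure IsFlow (M : MDP S A H) (q : Table S A H) : Prop where
  nonneg : ∀ h s a, 0 ≤ q h s a
  start : ∀ h : Fin H, (h : ℕ) = 0 → ∀ s, ∑ a, q h s a = (PMF.pure M.init s).toReal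
  step : ∀ h h' : Fin H, (h' : ℕ) = h + 1 → ∀ s',
    ∑ a, q h' s' a = ∑ s, ∑ a, q h s a * (M.p h s a s').toReal

lemma isFlow_occupancy (M : MDP S A H) (π : Policy S A H) : IsFlow M (occupancy M π) := by
  have key : ∀ h s, ∑ a, occupancy M π h s a = (stateLaw M π h h.2.le s).toReal := by
    intro h s
    simp only [occupancy_eq, ← Finset.mul_sum, sum_toReal_pmf, mul_one]
  refine ⟨fun h s a => ENNReal.toReal_nonneg, fun h hh s => ?_, fun h h' hh s' => ?_⟩
  · obtain ⟨h, hlt⟩ := h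
    subst hh
    rw [key, stateLaw_zero]
  · rw [key]
    obtain ⟨h', hlt⟩ := h'
    subst hh
    rw [stateLaw_succ, toReal_bind]
    refine Finset.sum_congr rfl fun s _ => ?_
    rw [toReal_bind, Finset.mul_sum]
    refine Finset.sum_congr rfl fun a _ => ?_
    rw [occupancy_eq]
    ring

/-- A flow is determined by its state masses and its conditional action probabilities. The
conditionals agree by `mul_policyOf`, and the flow equations carry equality of the state masses from
each step to the next. -/
lemma IsFlow.occupancy_policyOf [Nonempty A] {M : MDP S A H} {q : Table S A H} (hq : IsFlow M q) :
    occupancy M (policyOf q) = q := by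
  have hocc := isFlow_occupancy M (policyOf q)
  have hstate : ∀ h s, ∑ a, occupancy M (policyOf q) h s a
      = (stateLaw M (policyOf q) h h.2.le s).toReal := by
    intro h s
    simp only [occupancy_eq, ← Finset.mul_sum, sum_toReal_pmf, mul_one]
  have of_sum : ∀ h, (∀ s, ∑ a, occupancy M (policyOf q) h s a = ∑ a, q h s a) →
      occupancy M (policyOf q) h = q h := by
    intro h hs
    funext s a
    rw [occupancy_eq, ← hstate, hs, mul_policyOf q hq.nonneg]
  have : ∀ n (hn : n < H), occupancy M (policyOf q) ⟨n, hn⟩ = q ⟨n, hn⟩ := by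
    intro n
    induction n with
    | zero =>
      intro hn
      exact of_sum _ fun s => by rw [hocc.start _ rfl, hq.start _ rfl]
    | succ n ih =>
      intro hn
      refine of_sum _ fun s => ?_
      rw [hocc.step ⟨n, by omega⟩ _ rfl, hq.step ⟨n, by omega⟩ _ rfl, ih]
  funext h
  exact this h h.2

lemma mem_occSet_iff [Nonempty A] {M : MDP S A H} {q : Table S A H} : q ∈ occSet M ↔ IsFlow M q :=
  ⟨by rintro ⟨π, rfl⟩; exact isFlow_occupancy M π, fun hq => ⟨_, hq.occupancy_policyOf⟩⟩

lemma IsFlow.sum_eq_one {M : MDP S A H} {q : Table S A H} (hq : IsFlow M q) (h : Fin H) :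
    ∑ s, ∑ a, q h s a = 1 := by
  have : ∀ n (hn : n < H), ∑ s, ∑ a, q ⟨n, hn⟩ s a = 1 := by
    intro n
    induction n with
    | zero =>
      intro hn
      simp only [hq.start ⟨0, hn⟩ rfl, sum_toReal_pmf]
    | succ n ih =>
      intro hn
      simp only [hq.step ⟨n, by omega⟩ ⟨n + 1, hn⟩ rfl]
      rw [Finset.sum_comm, ← ih (by omega)]
      refine Finset.sum_congr rfl fun s _ => ?_
      rw [Finset.sum_comm]
      simp only [← Finset.mul_sum, sum_toReal_pmf, mul_one]
  exact this h h.2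

lemma IsFlow.le_one {M : MDP S A H} {q : Table S A H} (hq : IsFlow M q) (h : Fin H) (s : S)
    (a : A) : q h s a ≤ 1 := by
  rw [← hq.sum_eq_one h]
  exact (Finset.single_le_sum (fun a _ => hq.nonneg h s a) (Finset.mem_univ a)).trans
    (Finset.single_le_sum (f := fun s => ∑ a, q h s a)
      (fun s _ => Finset.sum_nonneg fun a _ => hq.nonneg h s a) (Finset.mem_univ s))

lemma convex_isFlow (M : MDP S A H) : Convex ℝ {q | IsFlow M q} := by
  rintro q (hq : IsFlow M q) r (hr : IsFlow M r) t u ht hu htu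
  refine ⟨fun h s a => ?_, fun h hh s => ?_, fun h h' hh s' => ?_⟩
  · have := hq.nonneg h s a
    have := hr.nonneg h s a
    simp only [Pi.add_apply, Pi.smul_apply, smul_eq_mul]
    positivity
  · simp only [Pi.add_apply, Pi.smul_apply, smul_eq_mul, Finset.sum_add_distrib,
      ← Finset.mul_sum, hq.start h hh, hr.start h hh]
    rw [← add_mul, htu, one_mul]
  · simp only [Pi.add_apply, Pi.smul_apply, smul_eq_mul, Finset.sum_add_distrib,
      ← Finset.mul_sum, hq.step h h' hh, hr.step h h' hh, add_mul, mul_assoc]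

lemma isCompact_isFlow (M : MDP S A H) : IsCompact {q | IsFlow M q} := by
  refine Metric.isCompact_of_isClosed_isBounded ?_ ?_
  · have : {q : Table S A H | IsFlow M q} =
        {q | ∀ h s a, 0 ≤ q h s a} ∩
        {q | ∀ h : Fin H, (h : ℕ) = 0 → ∀ s, ∑ a, q h s a = (PMF.pure M.init s).toReal} ∩
        {q | ∀ h h' : Fin H, (h' : ℕ) = h + 1 → ∀ s',
          ∑ a, q h' s' a = ∑ s, ∑ a, q h s a * (M.p h s a s').toReal} := by
      ext q
      exact ⟨fun h => ⟨⟨h.1, h.2⟩, h.3⟩, fun h => ⟨h.1.1, h.1.2, h.2⟩⟩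
    rw [this]
    refine (IsClosed.inter ?_ ?_).inter ?_
    · simp only [Set.ofPred_forall]
      exact isClosed_iInter fun h => isClosed_iInter fun s => isClosed_iInter fun a =>
        isClosed_le (by fun_prop) (by fun_prop)
    · simp only [Set.ofPred_forall]
      exact isClosed_iInter fun h => isClosed_iInter fun s => isClosed_iInter fun a =>
        isClosed_eq (by fun_prop) (by fun_prop)
    · simp only [Set.ofPred_forall]
      exact isClosed_iInter fun h => isClosed_iInter fun s => isClosed_iInter fun _ =>
        isClosed_iInter fun _ => isClosed_eq (by fun_prop) (by fun_prop)
  · refine (Metric.isBounded_closedBall (x := (0 : Table S A H)) (r := 1)).subset fun q hq => ?_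
    simp only [mem_closedBall_zero_iff]
    refine (pi_norm_le_iff_of_nonneg zero_le_one).2 fun h =>
      (pi_norm_le_iff_of_nonneg zero_le_one).2 fun s =>
      (pi_norm_le_iff_of_nonneg zero_le_one).2 fun a => ?_
    rw [Real.norm_of_nonneg (hq.nonneg h s a)]
    exact hq.le_one h s a

lemma sum_episode_indicator (M : MDP S A H) (π : Policy S A H) (h : Fin H) (s : S) (a : A) :
    open Classical in
    ∑ τ : Traj S A H, (episode M π τ).toReal * (if τ h = (s, a) then 1 else 0)
      = occupancy M π h s a := by
  classical
  rw [occupancy, PMF.toOuterMeasure_apply, tsum_fintype, ENNReal.toReal_sum]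
  · refine Finset.sum_congr rfl fun τ _ => ?_
    by_cases hτ : τ h = (s, a) <;> simp [hτ]
  · intro τ _
    by_cases hτ : τ h = (s, a) <;> simp [hτ, PMF.apply_ne_top]

/-- The expected value of a function of the trajectory which is linear in the visited pairs. -/
lemma sum_episode_mul_sum (M : MDP S A H) (π : Policy S A H) (g : Table S A H) :
    ∑ τ : Traj S A H, (episode M π τ).toReal * ∑ h, g h (τ h).1 (τ h).2
      = ∑ h, ∑ s, ∑ a, occupancy M π h s a * g h s a := by
  classical
  have h1 : ∀ τ : Traj S A H, ∀ h, g h (τ h).1 (τ h).2 =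
      ∑ s, ∑ a, (if τ h = (s, a) then 1 else 0) * g h s a := by
    intro τ h
    rw [← Fintype.sum_prod_type' (fun s a => (if τ h = (s, a) then 1 else 0) * g h s a)]
    simp
  simp only [h1, Finset.mul_sum]
  rw [Finset.sum_comm]
  refine Finset.sum_congr rfl fun h _ => ?_
  rw [Finset.sum_comm]
  refine Finset.sum_congr rfl fun s _ => ?_
  rw [Finset.sum_comm]
  refine Finset.sum_congr rfl fun a _ => ?_
  rw [← sum_episode_indicator, Finset.sum_mul]
  exact Finset.sum_congr rfl fun τ _ => by ring

lemma value_eq_pairing (M : MDP S A H) (π : Policy S A H) (c : Table S A H) :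
    value M π c = pairing (occupancy M π) c :=
  sum_episode_mul_sum M π c

end OccupancyPolytope

/-! ### One entropic mirror descent step on a finite index set. -/

section MirrorDescent

variable {ι : Type*} [Fintype ι]

/-- Follows from `(1 + x + x²/2)(1 - x + x²/2) = 1 + x⁴/4 ≥ 1`. -/
lemma exp_neg_le_quadratic {x : ℝ} (hx : 0 ≤ x) : Real.exp (-x) ≤ 1 - x + x ^ 2 / 2 := by
  have h1 := Real.quadratic_le_exp_of_nonneg hx
  rw [Real.exp_neg]
  have h2 : 0 < 1 + x + x ^ 2 / 2 := by positivity
  refine (inv_anti₀ h2 h1).trans ?_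
  rw [inv_le_iff_one_le_mul₀ h2]
  nlinarith [sq_nonneg (x ^ 2)]

/-- The tangent inequality of the convex function `y ↦ y log (y / a) - y` at `x`. -/
lemma entropy_tangent {a x y : ℝ} (ha : 0 < a) (hx : 0 < x) (hy : 0 ≤ y) :
    x * Real.log (x / a) - x + Real.log (x / a) * (y - x) ≤ y * Real.log (y / a) - y := by
  rcases hy.eq_or_lt with rfl | hy
  · simp; linarith
  · have h1 := Real.one_sub_inv_le_log_of_pos (div_pos hy hx)
    rw [Real.log_div hx.ne' ha.ne', Real.log_div hy.ne' ha.ne']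
    rw [Real.log_div hy.ne' hx.ne', inv_div] at h1
    have h2 : y * (1 - x / y) ≤ y * (Real.log y - Real.log x) := by gcongr
    have h3 : y * (1 - x / y) = y - x := by field_simp
    nlinarith

/-- The objective of a mirror descent step. -/
def stepObjective (l a q : ι → ℝ) : ℝ :=
  ∑ i, (l i * q i + (q i * Real.log (q i / a i) + a i - q i))

/-- By convexity the tangent at the moved point lies below the objective at `b`, so a decrease from
the moved point back to `b` forces this slope. It is taken at the moved point because at `b` itself
it could be `-∞`. -/
lemma stepObjective_slope_nonneg {l a b u : ι → ℝ} (hb : ∀ i, 0 ≤ b i) (hu : ∀ i, 0 ≤ u i)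
    (hba : ∀ i, 0 < b i → 0 < a i) (hua : ∀ i, 0 < u i → 0 < a i) {t : ℝ} (ht : 0 < t)
    (ht1 : t < 1)
    (hmin : stepObjective l a b ≤ stepObjective l a fun i => b i + t * (u i - b i)) :
    0 ≤ ∑ i, (l i + Real.log ((b i + t * (u i - b i)) / a i)) * (u i - b i) := by
  have key : ∀ i, (l i * (b i + t * (u i - b i)) + ((b i + t * (u i - b i)) *
      Real.log ((b i + t * (u i - b i)) / a i) + a i - (b i + t * (u i - b i)))) -
      (l i * b i + (b i * Real.log (b i / a i) + a i - b i)) ≤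
      t * ((l i + Real.log ((b i + t * (u i - b i)) / a i)) * (u i - b i)) := by
    intro i
    by_cases h0 : b i = 0 ∧ u i = 0
    · simp [h0.1, h0.2]
    · have hx : 0 < b i + t * (u i - b i) ∧ 0 < a i := by
        rcases (hb i).eq_or_lt with hb0 | hb0
        · have : 0 < u i := lt_of_le_of_ne (hu i) fun h => h0 ⟨hb0.symm, h.symm⟩
          exact ⟨by rw [← hb0]; simp; positivity, hua i this⟩
        · exact ⟨by nlinarith [hu i, mul_pos (sub_pos.2 ht1) hb0, mul_nonneg ht.le (hu i)],
            hba i hb0⟩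
      have := entropy_tangent hx.2 hx.1 (hb i)
      linarith
  have h2 := Finset.sum_le_sum fun i (_ : i ∈ Finset.univ) => key i
  rw [Finset.sum_sub_distrib, ← Finset.mul_sum] at h2
  unfold stepObjective at hmin
  exact nonneg_of_mul_nonneg_right (by linarith) ht

/-- A minimizer on a segment towards `u` is positive where `u` is. -/
lemma pos_of_stepObjective_min {l a b u : ι → ℝ} (hb : ∀ i, 0 ≤ b i) (hu : ∀ i, 0 ≤ u i)
    (hba : ∀ i, 0 < b i → 0 < a i) (hua : ∀ i, 0 < u i → 0 < a i)
    (hmin : ∀ t, 0 < t → t < 1 →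
      stepObjective l a b ≤ stepObjective l a fun i => b i + t * (u i - b i))
    (j : ι) (hj : 0 < u j) : 0 < b j := by
  classical
  by_contra hbj
  have hbj : b j = 0 := le_antisymm (not_lt.1 hbj) (hb j)
  have haj := hua j hj
  -- A bound on every summand of the slope, uniform in `t < 1/2`: the argument of the logarithm is
  -- at most `u i / a i` if the coordinate grows and at least `b i / 2 / a i` if it shrinks.
  let C : ι → ℝ := fun i => |l i * (u i - b i)| + |Real.log (u i / a i) * (u i - b i)|
    + |Real.log (b i / 2 / a i) * (u i - b i)|
  have hC : ∀ i t, 0 < t → t < 1 / 2 →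
      (l i + Real.log ((b i + t * (u i - b i)) / a i)) * (u i - b i) ≤ C i := by
    intro i t ht ht1
    have h1 : Real.log ((b i + t * (u i - b i)) / a i) * (u i - b i) ≤
        |Real.log (u i / a i) * (u i - b i)| + |Real.log (b i / 2 / a i) * (u i - b i)| := by
      rcases le_or_gt (u i) (b i) with h | h
      · rcases (hb i).eq_or_lt with hb0 | hb0
        · have : u i - b i = 0 := by linarith [hu i]
          simp [this]
        · have ha := hba i hb0
          have h3 : b i / 2 ≤ b i + t * (u i - b i) := by nlinarith [hu i]
          have h2 : Real.log (b i / 2 / a i) ≤ Real.log ((b i + t * (u i - b i)) / a i) := by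
            gcongr
          have h4 := mul_le_mul_of_nonpos_right h2 (sub_nonpos.2 h)
          linarith [le_abs_self (Real.log (b i / 2 / a i) * (u i - b i)),
            abs_nonneg (Real.log (u i / a i) * (u i - b i))]
      · have hu0 : 0 < u i := (hb i).trans_lt h
        have ha := hua i hu0
        have h3 : b i + t * (u i - b i) ≤ u i := by nlinarith
        have h5 : 0 < b i + t * (u i - b i) := by nlinarith [hb i, mul_pos ht (sub_pos.2 h)]
        have h2 : Real.log ((b i + t * (u i - b i)) / a i) ≤ Real.log (u i / a i) := by
          gcongr
        have h4 := mul_le_mul_of_nonneg_right h2 (sub_nonneg.2 h.le)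
        linarith [le_abs_self (Real.log (u i / a i) * (u i - b i)),
          abs_nonneg (Real.log (b i / 2 / a i) * (u i - b i))]
    have h2 := le_abs_self (l i * (u i - b i))
    simp only [C]
    linarith
  -- If `b j = 0 < u j`, the summand at `j` contains `log (t u j / a j)` and drags the whole slope
  -- to `-∞`, contradicting its nonnegativity.
  have hlim : Filter.Tendsto (fun t => ∑ i, C i + (l j + Real.log (t * u j / a j)) * u j)
      (nhdsWithin 0 (Set.Ioi 0)) Filter.atBot := by
    refine Filter.tendsto_atBot_add_const_left _ _
      (Filter.Tendsto.atBot_mul_const hj (Filter.tendsto_atBot_add_const_left _ _ ?_))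
    refine Real.tendsto_log_nhdsGT_zero.comp ?_
    refine tendsto_nhdsWithin_iff.2 ⟨?_, ?_⟩
    · refine Filter.Tendsto.mono_left ?_ nhdsWithin_le_nhds
      have : Continuous fun t : ℝ => t * u j / a j := by fun_prop
      simpa using this.tendsto 0
    · filter_upwards [self_mem_nhdsWithin] with t ht
      exact div_pos (mul_pos ht hj) haj
  obtain ⟨t, ht, ht1⟩ := ((hlim.eventually (Filter.eventually_lt_atBot 0)).and
    (Ioo_mem_nhdsGT (show (0 : ℝ) < 1 / 2 by norm_num))).exists
  have ht0 := ht1.1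
  have h1 := stepObjective_slope_nonneg hb hu hba hua ht0 (by linarith [ht1.2])
    (hmin t ht0 (by linarith [ht1.2]))
  rw [← Finset.add_sum_erase _ _ (Finset.mem_univ j)] at h1
  have h2 : ∑ i ∈ Finset.univ.erase j,
      (l i + Real.log ((b i + t * (u i - b i)) / a i)) * (u i - b i) ≤ ∑ i, C i :=
    (Finset.sum_le_sum fun i _ => hC i t ht0 ht1.2).trans
      (Finset.sum_le_sum_of_subset_of_nonneg (Finset.erase_subset _ _)
        fun i _ _ => by simp only [C]; positivity)
  simp only [hbj, zero_add, sub_zero] at h1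
  linarith

/-- The first-order optimality condition of a mirror descent step. -/
lemma variational_of_stepObjective_min {l a b u : ι → ℝ} (hb : ∀ i, 0 ≤ b i)
    (hu : ∀ i, 0 ≤ u i) (hba : ∀ i, 0 < b i → 0 < a i) (hub : ∀ i, 0 < u i → 0 < b i)
    (hmin : ∀ t, 0 < t → t < 1 →
      stepObjective l a b ≤ stepObjective l a fun i => b i + t * (u i - b i)) :
    0 ≤ ∑ i, (l i + (Real.log (b i) - Real.log (a i))) * (u i - b i) := by
  have hlim : Filter.Tendsto
      (fun t => ∑ i, (l i + Real.log ((b i + t * (u i - b i)) / a i)) * (u i - b i))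
      (nhdsWithin 0 (Set.Ioi 0))
      (nhds (∑ i, (l i + (Real.log (b i) - Real.log (a i))) * (u i - b i))) := by
    refine Filter.Tendsto.mono_left (tendsto_finsetSum _ fun i _ => ?_) nhdsWithin_le_nhds
    rcases (hb i).eq_or_lt with hb0 | hb0
    · have : u i = 0 := le_antisymm (not_lt.1 fun h => (hub i h).ne hb0) (hu i)
      simp [← hb0, this]
    · have ha := hba i hb0
      rw [← Real.log_div hb0.ne' ha.ne']
      have : ContinuousAt (fun t : ℝ =>
          (l i + Real.log ((b i + t * (u i - b i)) / a i)) * (u i - b i)) 0 := by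
        refine (continuousAt_const.add (ContinuousAt.log ?_ ?_)).mul continuousAt_const
        · have : Continuous fun t : ℝ => (b i + t * (u i - b i)) / a i := by fun_prop
          exact this.continuousAt
        · simp [hb0.ne', ha.ne']
      simpa using this.tendsto
  refine ge_of_tendsto hlim ?_
  filter_upwards [Ioo_mem_nhdsGT (zero_lt_one (α := ℝ))] with t ht
  exact stepObjective_slope_nonneg hb hu hba (fun i h => hba i (hub i h)) ht.1 ht.2
    (hmin t ht.1 ht.2)

/-- Over `b > 0` the difference of the two sides is extremal at `b = a exp (-l)`. Since `l ≥ 0`, the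
quadratic bound on `exp (-l)` needs no smallness of `l`. -/
lemma mirror_step_pointwise {a b l : ℝ} (ha : 0 < a) (hb : 0 < b) (hl : 0 ≤ l) :
    l * (a - b) - b * (Real.log b - Real.log a) ≤ a - b + a * l ^ 2 / 2 := by
  have h1 : Real.log (a * Real.exp (-l) / b) ≤ a * Real.exp (-l) / b - 1 :=
    Real.log_le_sub_one_of_pos (by positivity)
  rw [Real.log_div (by positivity) hb.ne', Real.log_mul ha.ne' (by positivity),
    Real.log_exp] at h1
  have h2 := mul_le_mul_of_nonneg_left h1 hb.le
  have h3 : b * (a * Real.exp (-l) / b - 1) = a * Real.exp (-l) - b := by field_simp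
  have h4 := mul_le_mul_of_nonneg_left (exp_neg_le_quadratic hl) ha.le
  nlinarith

/-- The progress made by one mirror descent step against the comparator `u`. -/
lemma mirror_step_le {l a b u : ι → ℝ} (ha : ∀ i, 0 ≤ a i) (hb : ∀ i, 0 ≤ b i)
    (hu : ∀ i, 0 ≤ u i) (hl : ∀ i, 0 ≤ l i)
    (hba : ∀ i, 0 < b i → 0 < a i) (hub : ∀ i, 0 < u i → 0 < b i)
    (hvar : 0 ≤ ∑ i, (l i + (Real.log (b i) - Real.log (a i))) * (u i - b i)) :
    ∑ i, l i * (a i - u i) ≤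
      ∑ i, (u i * Real.log (u i / a i) + a i - u i)
        - ∑ i, (u i * Real.log (u i / b i) + b i - u i) + ∑ i, a i * l i ^ 2 / 2 := by
  rw [← Finset.sum_sub_distrib, ← Finset.sum_add_distrib]
  refine (le_add_of_nonneg_right hvar).trans ?_
  rw [← Finset.sum_add_distrib]
  refine Finset.sum_le_sum fun i _ => ?_
  rcases (hb i).eq_or_lt with hb0 | hb0
  · have : u i = 0 := le_antisymm (not_lt.1 fun h => (hub i h).ne hb0) (hu i)
    rw [← hb0, this]
    simp only [sub_zero, mul_zero, add_zero, zero_mul, zero_add]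
    -- Both `b i` and `u i` vanish, and what remains is `a l ≤ a + a l²/2`.
    nlinarith [ha i, sq_nonneg (l i - 1), mul_nonneg (ha i) (sq_nonneg (l i - 1))]
  · have ha0 := hba i hb0
    have h1 := mirror_step_pointwise ha0 hb0 (hl i)
    rcases (hu i).eq_or_lt with hu0 | hu0
    · rw [← hu0]
      simp only [zero_mul, zero_add]
      linarith
    · rw [Real.log_div hu0.ne' ha0.ne', Real.log_div hu0.ne' hb0.ne']
      linarith

/-- The stability of a mirror descent step in `ℓ¹`. -/
lemma mirror_step_stability {l a b : ι → ℝ} {m : ℝ} (ha : ∀ i, 0 ≤ a i) (hb : ∀ i, 0 ≤ b i)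
    (hl : ∀ i, 0 ≤ l i) (hba : ∀ i, 0 < b i → 0 < a i) (hab : ∀ i, 0 < a i → 0 < b i)
    (hsa : ∑ i, a i = m) (hsb : ∑ i, b i = m)
    (hvar : 0 ≤ ∑ i, (l i + (Real.log (b i) - Real.log (a i))) * (a i - b i)) :
    ∑ i, |a i - b i| ≤ √(2 * m * ∑ i, a i * l i ^ 2) := by
  have hmax : ∀ i, 0 ≤ max (a i) (b i) := fun i => (ha i).trans (le_max_left _ _)
  -- The entropy part contributes at least `(a - b)²/max a b`. Where `b ≤ a`, half of it absorbs the
  -- loss term by AM-GM with weight `a`; where `a ≤ b`, the loss term is nonpositive. Thus only the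
  -- old iterate `a` occurs in the local norm.
  have key : ∀ i, (l i + (Real.log (b i) - Real.log (a i))) * (a i - b i) ≤
      a i * l i ^ 2 / 2 - (a i - b i) ^ 2 / max (a i) (b i) / 2 := by
    intro i
    rcases (ha i).eq_or_lt with ha0 | ha0
    · have : b i = 0 := le_antisymm (not_lt.1 fun h => (hba i h).ne ha0) (hb i)
      simp [← ha0, this]
    · have hb0 := hab i ha0
      rcases le_total (b i) (a i) with h | h
      · rw [max_eq_left h]
        have h1 := Real.one_sub_inv_le_log_of_pos (div_pos ha0 hb0)
        rw [Real.log_div ha0.ne' hb0.ne', inv_div] at h1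
        have h2 := mul_le_mul_of_nonneg_right h1 (sub_nonneg.2 h)
        have h3 : (1 - b i / a i) * (a i - b i) = (a i - b i) ^ 2 / a i := by field_simp
        have h4 : l i * (a i - b i) ≤ a i * l i ^ 2 / 2 + (a i - b i) ^ 2 / a i / 2 := by
          have : a i * l i ^ 2 / 2 + (a i - b i) ^ 2 / a i / 2 - l i * (a i - b i)
              = (a i * l i - (a i - b i)) ^ 2 / (2 * a i) := by field_simp; ring
          have h5 : 0 ≤ (a i * l i - (a i - b i)) ^ 2 / (2 * a i) := by positivity
          linarith
        linarith
      · rw [max_eq_right h]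
        have h1 := Real.one_sub_inv_le_log_of_pos (div_pos hb0 ha0)
        rw [Real.log_div hb0.ne' ha0.ne', inv_div] at h1
        have h2 := mul_le_mul_of_nonneg_right h1 (sub_nonneg.2 h)
        have h3 : (1 - a i / b i) * (b i - a i) = (a i - b i) ^ 2 / b i := by field_simp; ring
        have h4 : 0 ≤ l i * (b i - a i) := mul_nonneg (hl i) (sub_nonneg.2 h)
        have h5 : 0 ≤ a i * l i ^ 2 := by positivity
        have h6 : 0 ≤ (a i - b i) ^ 2 / b i := by positivity
        linarith
  have h1 := hvar.trans (Finset.sum_le_sum fun i _ => key i)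
  rw [Finset.sum_sub_distrib, ← Finset.sum_div, ← Finset.sum_div] at h1
  have h2 : ∑ i, max (a i) (b i) ≤ 2 * m := by
    rw [two_mul]
    nth_rewrite 1 [← hsa]
    rw [← hsb, ← Finset.sum_add_distrib]
    exact Finset.sum_le_sum fun i _ => max_le (by linarith [hb i]) (by linarith [ha i])
  -- Cauchy-Schwarz with the weights `max a b`, whose total is at most `2m`.
  have h3 := Finset.sum_sq_le_sum_mul_sum_of_sq_le_mul Finset.univ
    (r := fun i => |a i - b i|) (f := fun i => (a i - b i) ^ 2 / max (a i) (b i))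
    (g := fun i => max (a i) (b i)) (fun i _ => div_nonneg (sq_nonneg _) (hmax i))
    (fun i _ => hmax i) (fun i _ => le_of_eq <| by
      rw [sq_abs]
      rcases (hmax i).eq_or_lt with h | h
      · have h4 := le_max_left (a i) (b i)
        have h5 := le_max_right (a i) (b i)
        have : a i - b i = 0 := by linarith [ha i, hb i]
        simp [this]
      · field_simp)
  refine Real.le_sqrt_of_sq_le (h3.trans ?_)
  rw [mul_comm (2 * m)]
  refine mul_le_mul (by linarith) h2 (Finset.sum_nonneg fun i _ => hmax i) ?_
  exact Finset.sum_nonneg fun i _ => mul_nonneg (ha i) (sq_nonneg _)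

end MirrorDescent

/-! ### The iterates: dependence on the feedback, feasibility, positivity, and the law of the run.
-/

section Iteration

variable {S A : Type*} {H : ℕ}

/-- A table as a function on the finite set of all `(h, s, a)`. -/
def flat (q : Table S A H) (x : Fin H × S × A) : ℝ := q x.1 x.2.1 x.2.2

variable [Fintype S] [Fintype A]

lemma sum_flat (f : Fin H → S → A → ℝ) :
    ∑ h, ∑ s, ∑ a, f h s a = ∑ x : Fin H × S × A, f x.1 x.2.1 x.2.2 := by
  rw [Fintype.sum_prod_type]
  exact Finset.sum_congr rfl fun h _ => by rw [Fintype.sum_prod_type]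

lemma pairing_eq_sum (q c : Table S A H) : pairing q c = ∑ x, flat q x * flat c x :=
  sum_flat _

lemma KL_eq_sum (q q' : Table S A H) :
    KL q q' = ∑ x, (flat q x * Real.log (flat q x / flat q' x) + flat q' x - flat q x) :=
  sum_flat fun h s a => q h s a * Real.log (q h s a / q' h s a) + q' h s a - q h s a

lemma IsFlow.sum_flat_eq {M : MDP S A H} {q : Table S A H} (hq : IsFlow M q) :
    ∑ x, flat q x = H := by
  have := sum_flat q
  simp only [hq.sum_eq_one] at this
  simpa [flat] using this.symm

lemma objective_eq (η : ℝ) (q a L : Table S A H) :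
    η * pairing q L + KL q a = stepObjective (fun x => η * flat L x) (flat a) (flat q) := by
  rw [pairing_eq_sum, KL_eq_sum, stepObjective, Finset.sum_add_distrib, Finset.mul_sum]
  congr 1
  exact Finset.sum_congr rfl fun x _ => by ring

lemma continuous_objective (η : ℝ) (a L : Table S A H) :
    Continuous fun q => η * pairing q L + KL q a := by
  simp only [objective_eq, stepObjective]
  refine continuous_finsetSum _ fun x _ => ?_
  have hx : Continuous fun q : Table S A H => flat q x := by unfold flat; fun_prop
  have : Continuous fun q : Table S A H => flat q x * Real.log (flat q x / flat a x) := by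
    -- Where the reference table vanishes, division by zero and `log 0 = 0` make the term
    -- identically zero, so continuity holds for all tables.
    by_cases h : flat a x = 0
    · simp only [h, div_zero, Real.log_zero, mul_zero]
      exact continuous_const
    · have h1 : (fun q : Table S A H => flat q x * Real.log (flat q x / flat a x)) =
          fun q => flat a x * ((flat q x / flat a x) * Real.log (flat q x / flat a x)) := by
        funext q
        field_simp
      rw [h1]
      exact continuous_const.mul (Real.continuous_mul_log.comp (hx.div_const _))
  fun_prop

lemma IsFlow.flat_nonneg {M : MDP S A H} {q : Table S A H} (hq : IsFlow M q)
    (x : Fin H × S × A) : 0 ≤ flat q x := hq.nonneg _ _ _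

/-- The estimator of the costs of episode `j`. -/
def est (M : MDP S A H) (c : ℕ → Table S A H) (d : ℕ → ℕ) (η γ : ℝ) {n : ℕ}
    (ω : Fin n → Traj S A H) (j : Fin n) : Table S A H :=
  estimator γ (iterate M c d η γ ω j) (iterate M c d η γ ω (j + d j)) (c j) (ω j)

/-- The sum of the estimators which arrive at the end of episode `k`. -/
def arrived (M : MDP S A H) (c : ℕ → Table S A H) (d : ℕ → ℕ) (η γ : ℝ) {n : ℕ}
    (ω : Fin n → Traj S A H) (k : ℕ) : Table S A H :=
  ∑ j : Fin n, if (j : ℕ) + d j = k then est M c d η γ ω j else 0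

section IteratesCongr

variable (M : MDP S A H) (c : ℕ → Table S A H) (d : ℕ → ℕ) (η γ : ℝ) {n : ℕ}

lemma iterate_zero (ω : Fin n → Traj S A H) :
    iterate M c d η γ ω 0 = fun _ _ _ => 1 / ((Fintype.card S : ℝ) * Fintype.card A) := by
  rw [iterate]

lemma iterate_succ (ω : Fin n → Traj S A H) (k : ℕ) :
    iterate M c d η γ ω (k + 1) =
      omdStep M η (iterate M c d η γ ω k) (arrived M c d η γ ω k) := by
  rw [iterate]
  congr 1
  refine Finset.sum_congr rfl fun j _ => ?_
  by_cases h : (j : ℕ) + d j = k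
  · rw [dif_pos h, if_pos h, est, h]
  · rw [dif_neg h, if_neg h]

/-- Feedback of `j` enters in the step from `j + d j` to `j + d j + 1`. The strict inequality is
what makes `q^{j + d j}` independent of trajectory `j`. -/
lemma iterate_congr {ω ω' : Fin n → Traj S A H} {k : ℕ}
    (h : ∀ j : Fin n, (j : ℕ) + d j < k → ω j = ω' j) :
    iterate M c d η γ ω k = iterate M c d η γ ω' k := by
  induction k using Nat.strong_induction_on with
  | _ k ih =>
    rcases k with _ | k
    · rw [iterate_zero, iterate_zero]
    · have hle : ∀ m ≤ k, iterate M c d η γ ω m = iterate M c d η γ ω' m :=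
        fun m hm => ih m (by omega) fun j hj => h j (by omega)
      rw [iterate_succ, iterate_succ, hle k le_rfl]
      congr 1
      refine Finset.sum_congr rfl fun j _ => ?_
      by_cases hj : (j : ℕ) + d j = k
      · rw [if_pos hj, if_pos hj, est, est, hle j (by omega), hle _ hj.le, h j (by omega)]
      · rw [if_neg hj, if_neg hj]

/-- The feedback of the additional episode `n` arrives at the end of episode `n` or later and cannot
reach `q^k` for `k ≤ n`. -/
lemma iterate_init (ω : Fin (n + 1) → Traj S A H) {k : ℕ} (hk : k ≤ n) :
    iterate M c d η γ (Fin.init ω : Fin n → Traj S A H) k = iterate M c d η γ ω k := by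
  induction k using Nat.strong_induction_on with
  | _ k ih =>
    rcases k with _ | k
    · rw [iterate_zero, iterate_zero]
    · have hle : ∀ m ≤ k, iterate M c d η γ (Fin.init ω : Fin n → Traj S A H) m
          = iterate M c d η γ ω m :=
        fun m hm => ih m (by omega) (by omega)
      rw [iterate_succ, iterate_succ, hle k le_rfl]
      congr 1
      rw [arrived, arrived, Fin.sum_univ_castSucc, if_neg (by simp; omega), add_zero]
      refine Finset.sum_congr rfl fun j _ => ?_
      simp only [Fin.val_castSucc]
      by_cases hj : (j : ℕ) + d j = k
      · rw [if_pos hj, if_pos hj, est, est]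
        simp only [Fin.val_castSucc]
        rw [hle j (by omega), hle _ hj.le]
        rfl
      · rw [if_neg hj, if_neg hj]

end IteratesCongr

variable [Nonempty A]

/-- The flows form a nonempty compact set on which the continuous objective attains its minimum, so
`Classical.epsilon` selects a true minimizer. -/
lemma omdStep_spec (M : MDP S A H) (η : ℝ) (a L : Table S A H) :
    IsFlow M (omdStep M η a L) ∧
      ∀ u, IsFlow M u → η * pairing (omdStep M η a L) L + KL (omdStep M η a L) a ≤
        η * pairing u L + KL u a := by
  have hset : occSet M = {q | IsFlow M q} := Set.ext fun q => mem_occSet_iff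
  have hex : ∃ q₁, q₁ ∈ occSet M ∧
      IsMinOn (fun q' => η * pairing q' L + KL q' a) (occSet M) q₁ := by
    rw [hset]
    exact (isCompact_isFlow M).exists_isMinOn
      ⟨_, isFlow_occupancy M fun _ _ => PMF.uniformOfFintype A⟩
      (continuous_objective η a L).continuousOn
  obtain ⟨h1, h2⟩ := Classical.epsilon_spec hex
  exact ⟨mem_occSet_iff.1 h1, fun u hu => h2 (mem_occSet_iff.2 hu)⟩

/-- The occupancy measure of the uniform policy. -/
def uniformOcc (M : MDP S A H) : Table S A H :=
  occupancy M fun _ _ => PMF.uniformOfFintype A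

/-- The uniform policy plays every action with positive probability and so reaches whatever some
policy reaches. Using it as comparator makes the iterates positive wherever any flow is. -/
lemma IsFlow.uniformOcc_pos {M : MDP S A H} {q : Table S A H} (hq : IsFlow M q) (h : Fin H)
    (s : S) (a : A) (hpos : 0 < q h s a) : 0 < uniformOcc M h s a := by
  obtain ⟨π, rfl⟩ := mem_occSet_iff.2 hq
  have hs : ∀ n (hn : n ≤ H) s, s ∈ (stateLaw M π n hn).support →
      s ∈ (stateLaw M (fun _ _ => PMF.uniformOfFintype A) n hn).support := by
    intro n
    induction n with
    | zero => intro hn s; simp [stateLaw_zero]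
    | succ n ih =>
      intro hn s
      simp only [stateLaw_succ, PMF.mem_support_bind_iff]
      rintro ⟨s', hs', a, -, ha⟩
      exact ⟨s', ih _ s' hs', a, by simp, ha⟩
  rw [occupancy_eq] at hpos
  have h1 : s ∈ (stateLaw M π h h.2.le).support := by
    rw [PMF.mem_support_iff]
    intro h0
    simp [h0] at hpos
  rw [uniformOcc, occupancy_eq]
  have h2 := (PMF.mem_support_iff _ _).1 (hs _ _ _ h1)
  refine mul_pos (ENNReal.toReal_pos h2 (PMF.apply_ne_top _ _)) (ENNReal.toReal_pos ?_
    (PMF.apply_ne_top _ _))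
  simp

/-- Nonnegative tables which are positive at all reachable `(h, s, a)`. -/
structure IsRegular (M : MDP S A H) (q : Table S A H) : Prop where
  nonneg : ∀ x, 0 ≤ flat q x
  pos : ∀ x, 0 < flat (uniformOcc M) x → 0 < flat q x

lemma IsRegular.pos_of_flow {M : MDP S A H} {q u : Table S A H} (hq : IsRegular M q)
    (hu : IsFlow M u) (x : Fin H × S × A) (hx : 0 < flat u x) : 0 < flat q x :=
  hq.pos x (hu.uniformOcc_pos _ _ _ hx)

lemma stepObjective_omdStep_le (M : MDP S A H) (η : ℝ) (a L : Table S A H) {u : Table S A H}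
    (hu : IsFlow M u) (t : ℝ) (ht : 0 < t) (ht1 : t < 1) :
    stepObjective (fun x => η * flat L x) (flat a) (flat (omdStep M η a L)) ≤
      stepObjective (fun x => η * flat L x) (flat a) fun x =>
        flat (omdStep M η a L) x + t * (flat u x - flat (omdStep M η a L) x) := by
  obtain ⟨hb, hmin⟩ := omdStep_spec M η a L
  have h1 := hmin _ (convex_isFlow M hb hu (sub_nonneg.2 ht1.le) ht.le (sub_add_cancel 1 t))
  rw [objective_eq, objective_eq] at h1
  refine h1.trans_eq (congrArg _ (funext fun x => ?_))
  simp only [flat, Pi.add_apply, Pi.smul_apply, smul_eq_mul]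
  ring

lemma isRegular_omdStep {M : MDP S A H} (η : ℝ) {a : Table S A H} (L : Table S A H)
    (ha : IsRegular M a) : IsRegular M (omdStep M η a L) := by
  have hb := (omdStep_spec M η a L).1
  have hr : IsFlow M (uniformOcc M) := isFlow_occupancy M _
  exact ⟨hb.flat_nonneg, pos_of_stepObjective_min hb.flat_nonneg hr.flat_nonneg
    (ha.pos_of_flow hb) (ha.pos_of_flow hr) (stepObjective_omdStep_le M η a L hr)⟩

lemma omdStep_variational {M : MDP S A H} (η : ℝ) {a : Table S A H} (L : Table S A H)
    (ha : IsRegular M a) {u : Table S A H} (hu : IsFlow M u) :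
    0 ≤ ∑ x, (η * flat L x + (Real.log (flat (omdStep M η a L) x) - Real.log (flat a x)))
      * (flat u x - flat (omdStep M η a L) x) := by
  have hb := (omdStep_spec M η a L).1
  exact variational_of_stepObjective_min hb.flat_nonneg hu.flat_nonneg (ha.pos_of_flow hb)
    ((isRegular_omdStep η L ha).pos_of_flow hu) (stepObjective_omdStep_le M η a L hu)

section Iterates

variable (M : MDP S A H) (c : ℕ → Table S A H) (d : ℕ → ℕ) (η γ : ℝ) {n : ℕ}

lemma iterate_isFlow (ω : Fin n → Traj S A H) {k : ℕ} (hk : 0 < k) :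
    IsFlow M (iterate M c d η γ ω k) := by
  obtain ⟨k, rfl⟩ := Nat.exists_eq_succ_of_ne_zero hk.ne'
  rw [Nat.succ_eq_add_one, iterate_succ]
  exact (omdStep_spec M η _ _).1

lemma iterate_isRegular (ω : Fin n → Traj S A H) (k : ℕ) :
    IsRegular M (iterate M c d η γ ω k) := by
  induction k with
  | zero =>
    have : Nonempty S := ⟨M.init⟩
    have hpos : 0 < 1 / ((Fintype.card S : ℝ) * Fintype.card A) := by
      have := Fintype.card_pos (α := S)
      have := Fintype.card_pos (α := A)
      positivity
    rw [iterate_zero]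
    exact ⟨fun x => hpos.le, fun x _ => hpos⟩
  | succ k ih =>
    rw [iterate_succ]
    exact isRegular_omdStep η _ ih

lemma occupancy_policy (ω : Fin n → Traj S A H) {k : ℕ} (hk : 0 < k) :
    occupancy M (policy M c d η γ ω k) = iterate M c d η γ ω k :=
  (iterate_isFlow M c d η γ ω hk).occupancy_policyOf

/-- The law of the run factorizes into the laws of the episodes. -/
lemma run_apply (n : ℕ) (ω : Fin n → Traj S A H) :
    run M c d η γ n ω = ∏ j : Fin n, episode M (policy M c d η γ ω j) (ω j) := by
  classical
  induction n with
  | zero =>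
    rw [run, PMF.pure_apply, if_pos (Subsingleton.elim _ _)]
    simp
  | succ n ih =>
    rw [run, PMF.bind_apply, tsum_eq_single (Fin.init ω : Fin n → Traj S A H)]
    · rw [ih, PMF.map_apply, tsum_eq_single (ω (Fin.last n)), if_pos (Fin.snoc_init_self ω).symm,
        Fin.prod_univ_castSucc]
      · congr 1
        · refine Finset.prod_congr rfl fun j _ => ?_
          rw [policy, policy, iterate_init M c d η γ ω (by omega)]
          rfl
        · rw [policy, policy, iterate_init M c d η γ ω le_rfl]
          rfl
      · intro τ hτ
        refine if_neg fun h => hτ ?_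
        rw [h, Fin.snoc_last]
    · intro ω' hω'
      rw [PMF.map_apply, mul_eq_zero]
      right
      rw [ENNReal.tsum_eq_zero]
      intro τ
      refine if_neg fun h => hω' ?_
      rw [h, Fin.init_snoc]

end Iterates

end Iteration

/-! ### Summation of a product of conditional densities in an arbitrary order. -/

section ProductMartingale

variable {ι T : Type*} [Fintype ι] [DecidableEq ι] [Fintype T]

/-- Exchanging `ω j` with the fresh value `τ` is an involution of the set of pairs `(ω, τ)`. -/
lemma sum_sum_update (j : ι) (F : (ι → T) → ℝ) :
    ∑ ω, ∑ τ, F (Function.update ω j τ) = Fintype.card T * ∑ ω, F ω := by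
  rw [← Fintype.sum_prod_type' fun ω τ => F (Function.update ω j τ)]
  let e : (ι → T) × T → (ι → T) × T := fun x => (Function.update x.1 j x.2, x.1 j)
  have he : Function.Involutive e := by
    rintro ⟨ω, τ⟩
    simp [e]
  have h := Fintype.sum_equiv he.toPerm (fun x => F (Function.update x.1 j x.2))
    (fun x : (ι → T) × T => F x.1) fun x => rfl
  rw [h, Fintype.sum_prod_type]
  simp [Finset.mul_sum]

/-- A product of nonnegative functions, each of which has conditional mass at most one given the
coordinates of smaller rank, has total mass at most one. -/
lemma sum_prod_le_one [Nonempty T] (r : ι → ℕ) (hr : Function.Injective r)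
    (g : ι → (ι → T) → ℝ) (h0 : ∀ j ω, 0 ≤ g j ω)
    (hdep : ∀ j ω ω', (∀ i, r i ≤ r j → ω i = ω' i) → g j ω = g j ω')
    (h1 : ∀ j ω, ∑ τ, g j (Function.update ω j τ) ≤ 1) :
    ∑ ω, ∏ j, g j ω ≤ 1 := by
  have hT : (0 : ℝ) < Fintype.card T := by exact_mod_cast Fintype.card_pos
  -- Coordinates not yet covered by a factor are free and contribute `|T|` each. Hence every new
  -- factor, with conditional mass at most one, is worth `1/|T|`; the powers keep this account.
  have key : ∀ m : ℕ, (∑ ω, ∏ j ∈ Finset.univ.filter (fun j => r j < m), g j ω) *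
      (Fintype.card T : ℝ) ^ (Finset.univ.filter (fun j => r j < m)).card ≤
      (Fintype.card T : ℝ) ^ (Fintype.card ι) := by
    intro m
    induction m with
    | zero => simp
    | succ m ih =>
      by_cases hm : ∃ j, r j = m
      · obtain ⟨j, rfl⟩ := hm
        have hs : Finset.univ.filter (fun i => r i < r j + 1) =
            insert j (Finset.univ.filter (fun i => r i < r j)) := by
          ext i
          simp only [Finset.mem_filter, Finset.mem_univ, true_and, Finset.mem_insert]
          rw [Nat.lt_succ_iff_lt_or_eq, or_comm, hr.eq_iff]
        have hj : j ∉ Finset.univ.filter (fun i => r i < r j) := by simp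
        rw [hs, Finset.card_insert_of_notMem hj]
        simp only [Finset.prod_insert hj]
        refine le_trans ?_ ih
        rw [pow_succ', ← mul_assoc, mul_comm _ (Fintype.card T : ℝ), ← sum_sum_update j]
        gcongr with ω
        have h2 : ∀ τ, ∏ i ∈ Finset.univ.filter (fun i => r i < r j),
            g i (Function.update ω j τ) = ∏ i ∈ Finset.univ.filter (fun i => r i < r j), g i ω := by
          intro τ
          refine Finset.prod_congr rfl fun i hi => hdep i _ _ fun k hk => ?_
          simp only [Finset.mem_filter, Finset.mem_univ, true_and] at hi
          exact Function.update_of_ne (fun h => by subst h; omega) _ _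
        simp only [h2, ← Finset.sum_mul]
        exact mul_le_of_le_one_left (Finset.prod_nonneg fun i _ => h0 i ω) (h1 j ω)
      · have hs : Finset.univ.filter (fun i => r i < m + 1) =
            Finset.univ.filter (fun i => r i < m) := by
          ext i
          simp only [Finset.mem_filter, Finset.mem_univ, true_and]
          have : r i ≠ m := fun h => hm ⟨i, h⟩
          omega
        rw [hs]
        exact ih
  have h2 := key (Finset.univ.sup r + 1)
  have hs : Finset.univ.filter (fun i => r i < Finset.univ.sup r + 1) = Finset.univ := by
    ext i
    simpa using Nat.lt_succ_of_le (Finset.le_sup (Finset.mem_univ i))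
  rw [hs, Finset.card_univ] at h2
  exact le_of_mul_le_mul_right (by simpa using h2) (pow_pos hT (Fintype.card ι))

end ProductMartingale

/-! ### Tail bounds along the arrival order. -/

section Concentration

variable {S A : Type*} {H : ℕ} [Fintype S] [Fintype A] [Nonempty A]
  (M : MDP S A H) (c : ℕ → Table S A H) (d : ℕ → ℕ) (η γ : ℝ) {n : ℕ}

/-- The expectation of a function of the trajectory of episode `j`, given the other episodes. -/
def epExp (ω : Fin n → Traj S A H) (j : Fin n) (f : Traj S A H → ℝ) : ℝ :=
  ∑ τ : Traj S A H, (episode M (policy M c d η γ ω j) τ).toReal * f τ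

lemma epExp_mono (ω : Fin n → Traj S A H) (j : Fin n) {f g : Traj S A H → ℝ}
    (h : ∀ τ, f τ ≤ g τ) : epExp M c d η γ ω j f ≤ epExp M c d η γ ω j g :=
  Finset.sum_le_sum fun τ _ => mul_le_mul_of_nonneg_left (h τ) ENNReal.toReal_nonneg

lemma epExp_affine (ω : Fin n → Traj S A H) (j : Fin n) (f : Traj S A H → ℝ) (s t : ℝ) :
    epExp M c d η γ ω j (fun τ => s + t * f τ) = s + t * epExp M c d η γ ω j f := by
  simp only [epExp, mul_add, Finset.sum_add_distrib, ← Finset.sum_mul, sum_toReal_pmf, one_mul,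
    Finset.mul_sum]
  congr 1
  exact Finset.sum_congr rfl fun τ _ => by ring

lemma epExp_mul_const (ω : Fin n → Traj S A H) (j : Fin n) (f : Traj S A H → ℝ) (t : ℝ) :
    epExp M c d η γ ω j (fun τ => f τ * t) = epExp M c d η γ ω j f * t := by
  simp only [epExp, Finset.sum_mul, mul_assoc]

/-- A function of the run depends, for episode `j`, only on the episodes whose feedback arrives
no later than the feedback of `j` (ties being broken by the index). -/
def ArrivalAdapted {n : ℕ} {β : Type*} (X : Fin n → (Fin n → Traj S A H) → β) : Prop :=
  ∀ (j : Fin n) ω ω', (∀ i : Fin n, (i : ℕ) + d i < j + d j ∨ ((i : ℕ) + d i = j + d j ∧ i ≤ j) →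
    ω i = ω' i) → X j ω = X j ω'

/-- The exponential tail bound along the arrival order. -/
lemma run_exp_tail (ξ : Fin n → (Fin n → Traj S A H) → ℝ) (hdep : ArrivalAdapted d ξ)
    (hexp : ∀ j ω, epExp M c d η γ ω j
      (fun τ => Real.exp (ξ j (Function.update ω j τ))) ≤ 1) {ε : ℝ} (hε : 0 < ε) :
    open Classical in
    ∑ ω : Fin n → Traj S A H with Real.log (1 / ε) < ∑ j, ξ j ω,
      (run M c d η γ n ω).toReal ≤ ε := by
  classical
  have hne : Nonempty (Traj S A H) := ⟨fun _ => (M.init, Classical.arbitrary A)⟩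
  have hpol : ∀ (j : Fin n) (ω ω' : Fin n → Traj S A H),
      (∀ i : Fin n, (i : ℕ) + d i < j → ω i = ω' i) →
      policy M c d η γ ω j = policy M c d η γ ω' j := by
    intro j ω ω' h
    rw [policy, policy, iterate_congr M c d η γ h]
  have hrank : ∀ i j : Fin n, (i : ℕ) + d i < j + d j ∨ ((i : ℕ) + d i = j + d j ∧ i ≤ j) →
      ((i : ℕ) + d i) * n + i ≤ ((j : ℕ) + d j) * n + j := by
    rintro i j (h | ⟨h, h'⟩)
    · have := Nat.mul_le_mul_right n (Nat.succ_le_of_lt h)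
      have := i.2
      rw [Nat.succ_mul] at *
      omega
    · rw [h]
      exact Nat.add_le_add_left h' _
  have hone : ∑ ω : Fin n → Traj S A H,
      ∏ j : Fin n, (episode M (policy M c d η γ ω j) (ω j)).toReal * Real.exp (ξ j ω) ≤ 1 := by
    -- Since `j < n`, this rank encodes the lexicographic order on arrival time and index.
    refine sum_prod_le_one (fun j : Fin n => ((j : ℕ) + d j) * n + j) ?_
      (fun j ω => (episode M (policy M c d η γ ω j) (ω j)).toReal * Real.exp (ξ j ω))
      (fun j ω => mul_nonneg ENNReal.toReal_nonneg (Real.exp_nonneg _)) ?_ ?_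
    · intro i j h
      have h1 := congrArg (· % n) h
      simp only [Nat.mul_add_mod_self_right, Nat.mod_eq_of_lt i.2, Nat.mod_eq_of_lt j.2] at h1
      exact Fin.ext h1
    · intro j ω ω' h
      have h1 := hdep j ω ω' fun i hi => h i (hrank i j hi)
      have h2 := hpol j ω ω' fun i hi => h i (hrank i j (Or.inl (by omega)))
      simp only [h1, h2, h j le_rfl]
    · intro j ω
      refine le_trans (le_of_eq (Finset.sum_congr rfl fun τ _ => ?_)) (hexp j ω)
      have h2 := hpol j (Function.update ω j τ) ω fun i hi =>
        Function.update_of_ne (fun h => by subst h; omega) _ _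
      simp only [h2, Function.update_self]
  have hstep : ∑ ω : Fin n → Traj S A H with Real.log (1 / ε) < ∑ j, ξ j ω,
      (run M c d η γ n ω).toReal * (1 / ε) ≤ 1 := by
    refine le_trans ?_ hone
    refine le_trans ?_ (Finset.sum_le_sum_of_subset_of_nonneg (Finset.filter_subset
      (fun ω => Real.log (1 / ε) < ∑ j, ξ j ω) _) fun ω _ _ => Finset.prod_nonneg fun j _ =>
        mul_nonneg ENNReal.toReal_nonneg (Real.exp_nonneg _))
    refine Finset.sum_le_sum fun ω hω => ?_
    rw [Finset.prod_mul_distrib, ← Real.exp_sum, run_apply, ENNReal.toReal_prod]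
    refine mul_le_mul_of_nonneg_left ?_ (Finset.prod_nonneg fun j _ => ENNReal.toReal_nonneg)
    rw [← Real.log_le_iff_le_exp (by positivity)]
    exact (Finset.mem_filter.1 hω).2.le
  rw [← Finset.sum_mul, mul_one_div, div_le_one hε] at hstep
  exact hstep

/-- The tail bound for sums of bounded nonnegative variables. -/
lemma run_upper_tail (X : Fin n → (Fin n → Traj S A H) → ℝ) (hdep : ArrivalAdapted d X)
    (μ : Fin n → ℝ) {R : ℝ} (hR : 0 < R) (hX0 : ∀ j ω, 0 ≤ X j ω) (hXR : ∀ j ω, X j ω ≤ R)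
    (hμ : ∀ j ω, epExp M c d η γ ω j (fun τ => X j (Function.update ω j τ)) ≤ μ j)
    {ε : ℝ} (hε : 0 < ε) :
    open Classical in
    ∑ ω : Fin n → Traj S A H with 2 * ∑ j, μ j + R * Real.log (1 / ε) < ∑ j, X j ω,
      (run M c d η γ n ω).toReal ≤ ε := by
  classical
  refine le_trans (le_of_eq (Finset.sum_congr (Finset.filter_congr fun ω _ => ?_) fun _ _ => rfl))
    -- After scaling by `R`, `exp x ≤ 1 + 2x` on `[0, 1]` bounds the conditional mean by `exp (2 μ /
    -- R)`; this is the source of the factor `2` before the means.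
    (run_exp_tail M c d η γ (fun j ω => R⁻¹ * X j ω - 2 * R⁻¹ * μ j) ?_ ?_ hε)
  · rw [Finset.sum_sub_distrib, ← Finset.mul_sum, ← Finset.mul_sum, lt_sub_iff_add_lt,
      lt_inv_mul_iff₀ hR]
    rw [show R * (Real.log (1 / ε) + 2 * R⁻¹ * ∑ j, μ j)
      = 2 * ∑ j, μ j + R * Real.log (1 / ε) by field_simp; ring]
  · intro j ω ω' h
    simp only [hdep j ω ω' h]
  · intro j ω
    have hexp2 : ∀ x : ℝ, 0 ≤ x → x ≤ 1 → Real.exp x ≤ 1 + 2 * x := by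
      intro x h0 h1
      have := Real.abs_exp_sub_one_le (x := x) (by rw [abs_of_nonneg h0]; exact h1)
      rw [abs_of_nonneg h0] at this
      linarith [le_abs_self (Real.exp x - 1)]
    simp only [Real.exp_sub, div_eq_mul_inv, epExp_mul_const]
    rw [← div_eq_mul_inv, div_le_one (Real.exp_pos _)]
    calc epExp M c d η γ ω j (fun τ => Real.exp (R⁻¹ * X j (Function.update ω j τ)))
        ≤ epExp M c d η γ ω j (fun τ => 1 + 2 * R⁻¹ * X j (Function.update ω j τ)) := by
          refine epExp_mono M c d η γ ω j fun τ => ?_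
          rw [mul_assoc]
          refine hexp2 _ (mul_nonneg (inv_nonneg.2 hR.le) (hX0 _ _)) ?_
          rw [inv_mul_le_one₀ hR]
          exact hXR _ _
      _ ≤ 1 + 2 * R⁻¹ * μ j := by
          rw [epExp_affine]
          gcongr
          exact hμ j ω
      _ ≤ Real.exp (2 * R⁻¹ * μ j) := by linarith [Real.add_one_le_exp (2 * R⁻¹ * μ j)]

/-- The lower tail bound for sums of bounded nonnegative variables. -/
lemma run_lower_tail (X : Fin n → (Fin n → Traj S A H) → ℝ) (hdep : ArrivalAdapted d X)
    (μ : Fin n → (Fin n → Traj S A H) → ℝ) (hμdep : ArrivalAdapted d μ) {B lam : ℝ}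
    (hlam : 0 < lam) (hX0 : ∀ j ω, 0 ≤ X j ω) (hXB : ∀ j ω, X j ω ≤ B)
    (hμ : ∀ j ω τ, μ j (Function.update ω j τ)
      = epExp M c d η γ ω j (fun τ => X j (Function.update ω j τ)))
    {ε : ℝ} (hε : 0 < ε) :
    open Classical in
    ∑ ω : Fin n → Traj S A H with
      lam * B ^ 2 / 2 * n + Real.log (1 / ε) / lam < ∑ j, (μ j ω - X j ω),
      (run M c d η γ n ω).toReal ≤ ε := by
  classical
  refine le_trans (le_of_eq (Finset.sum_congr (Finset.filter_congr fun ω _ => ?_) fun _ _ => rfl))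
    (run_exp_tail M c d η γ
      (fun j ω => - (lam * X j ω) - (lam ^ 2 * B ^ 2 / 2 - lam * μ j ω)) ?_ ?_ hε)
  · have h1 : ∑ j, (- (lam * X j ω) - (lam ^ 2 * B ^ 2 / 2 - lam * μ j ω))
        = lam * (∑ j, (μ j ω - X j ω) - lam * B ^ 2 / 2 * n) := by
      simp only [Finset.sum_sub_distrib, Finset.sum_neg_distrib, ← Finset.mul_sum,
        Finset.sum_const, Finset.card_univ, Fintype.card_fin, nsmul_eq_mul]
      ring
    rw [h1, ← div_lt_iff₀' hlam, lt_sub_iff_add_lt']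
  · intro j ω ω' h
    simp only [hdep j ω ω' h, hμdep j ω ω' h]
  · intro j ω
    simp only [hμ, Real.exp_sub (-_), div_eq_mul_inv, epExp_mul_const]
    rw [← div_eq_mul_inv, div_le_one (Real.exp_pos _)]
    calc epExp M c d η γ ω j (fun τ => Real.exp (-(lam * X j (Function.update ω j τ))))
        ≤ epExp M c d η γ ω j (fun τ => (1 + lam ^ 2 * B ^ 2 / 2) +
            (- lam) * X j (Function.update ω j τ)) := by
          refine epExp_mono M c d η γ ω j fun τ => ?_
          have h0 := hX0 j (Function.update ω j τ)
          have h1 := exp_neg_le_quadratic (mul_nonneg hlam.le h0)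
          have h2 : X j (Function.update ω j τ) ^ 2 ≤ B ^ 2 :=
            pow_le_pow_left₀ h0 (hXB _ _) 2
          nlinarith [mul_le_mul_of_nonneg_left h2 (sq_nonneg lam)]
      _ ≤ _ := by
          rw [epExp_affine]
          refine le_trans (le_of_eq ?_) (Real.add_one_le_exp _)
          simp only [div_eq_mul_inv]
          ring

end Concentration

/-! ### Moments and concentration of the delay-adapted estimators. -/

section CostEstimators

variable {S A : Type*} {H : ℕ}

open Classical in
/-- The indicator of the event that the trajectory visits `(s, a)` at step `h`. -/
def visit (τ : Traj S A H) (x : Fin H × S × A) : ℝ := if τ x.1 = x.2 then 1 else 0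

lemma visit_nonneg (τ : Traj S A H) (x : Fin H × S × A) : 0 ≤ visit τ x := by
  unfold visit; split_ifs <;> norm_num

lemma visit_le_one (τ : Traj S A H) (x : Fin H × S × A) : visit τ x ≤ 1 := by
  unfold visit; split_ifs <;> norm_num

variable [Fintype S] [Fintype A]

lemma sum_visit_mul (τ : Traj S A H) (g : Fin H × S × A → ℝ) :
    ∑ x, visit τ x * g x = ∑ h, g (h, τ h) := by
  classical
  rw [Fintype.sum_prod_type]
  refine Finset.sum_congr rfl fun h _ => ?_
  simp [visit]

lemma sum_visit_mul_le (τ : Traj S A H) {g : Fin H × S × A → ℝ} {B : ℝ} (hg : ∀ x, g x ≤ B) :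
    ∑ x, visit τ x * g x ≤ H * B := by
  rw [sum_visit_mul]
  exact (Finset.sum_le_sum fun h _ => hg _).trans (by simp)

section Estimators

variable (M : MDP S A H) (c : ℕ → Table S A H) (d : ℕ → ℕ) (η γ : ℝ) {n : ℕ}

/-- The factor by which the indicator of a visit is multiplied in the estimator. -/
def factor (ω : Fin n → Traj S A H) (j : Fin n) (x : Fin H × S × A) : ℝ :=
  flat (c j) x / (max (flat (iterate M c d η γ ω j) x)
    (flat (iterate M c d η γ ω (j + d j)) x) + γ)

lemma flat_est (ω : Fin n → Traj S A H) (j : Fin n) (x : Fin H × S × A) :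
    flat (est M c d η γ ω j) x = visit (ω j) x * factor M c d η γ ω j x := by
  simp only [flat, est, estimator, visit, factor, Prod.mk.eta]
  ring

/-- The factor of the estimator, set to zero for the initial episode, whose iterate is not an
occupancy measure. -/
def lateFactor (ω : Fin n → Traj S A H) (j : Fin n) (x : Fin H × S × A) : ℝ :=
  if (j : ℕ) = 0 then 0 else factor M c d η γ ω j x

/-- The estimator, set to zero for the initial episode. -/
def lateEst (ω : Fin n → Traj S A H) (j : Fin n) (x : Fin H × S × A) : ℝ :=
  visit (ω j) x * lateFactor M c d η γ ω j x

lemma flat_est_eq_lateEst (ω : Fin n → Traj S A H) {j : Fin n} (hj : (j : ℕ) ≠ 0)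
    (x : Fin H × S × A) : flat (est M c d η γ ω j) x = lateEst M c d η γ ω j x := by
  rw [flat_est, lateEst, lateFactor, if_neg hj]

lemma adapted_iterate {m : Fin n → ℕ} (hm : ∀ j : Fin n, m j ≤ j + d j) :
    ArrivalAdapted d fun (j : Fin n) (ω : Fin n → Traj S A H) =>
      iterate M c d η γ ω (m j) :=
  fun j _ _ h => iterate_congr M c d η γ fun i hi => h i (Or.inl (hi.trans_le (hm j)))

lemma iterate_update (ω : Fin n → Traj S A H) {j : Fin n} (τ : Traj S A H) {m : ℕ}
    (hm : m ≤ j + d j) :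
    iterate M c d η γ (Function.update ω j τ) m = iterate M c d η γ ω m :=
  iterate_congr M c d η γ fun i hi =>
    Function.update_of_ne (fun h => by subst h; omega) _ _

lemma adapted_factor : ArrivalAdapted d fun (j : Fin n) (ω : Fin n → Traj S A H) =>
    factor M c d η γ ω j := by
  intro j ω ω' h
  funext x
  have h1 := adapted_iterate M c d η γ (m := fun j => j) (fun j => Nat.le_add_right _ _) j ω ω' h
  have h2 := adapted_iterate M c d η γ (m := fun j => j + d j) (fun j => le_rfl) j ω ω' h
  simp only at h1 h2
  simp only [factor, h1, h2]

lemma adapted_lateFactor : ArrivalAdapted d fun (j : Fin n) (ω : Fin n → Traj S A H) =>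
    lateFactor M c d η γ ω j := by
  intro j ω ω' h
  have := adapted_factor M c d η γ j ω ω' h
  simp only at this
  funext x
  simp only [lateFactor, this]

lemma adapted_lateEst : ArrivalAdapted d fun (j : Fin n) (ω : Fin n → Traj S A H) =>
    lateEst M c d η γ ω j := by
  intro j ω ω' h
  have h1 := adapted_lateFactor M c d η γ j ω ω' h
  simp only at h1
  funext x
  simp only [lateEst, h1, h j (Or.inr ⟨rfl, le_rfl⟩)]

lemma factor_update (ω : Fin n → Traj S A H) (i j : Fin n) (τ : Traj S A H)
    (hij : (i : ℕ) + d i ≤ j + d j) :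
    factor M c d η γ (Function.update ω j τ) i = factor M c d η γ ω i := by
  funext x
  simp only [factor]
  rw [iterate_update M c d η γ ω τ (by omega), iterate_update M c d η γ ω τ hij]

lemma lateEst_update (ω : Fin n → Traj S A H) (j : Fin n) (τ : Traj S A H)
    (x : Fin H × S × A) :
    lateEst M c d η γ (Function.update ω j τ) j x = visit τ x * lateFactor M c d η γ ω j x := by
  simp only [lateEst, lateFactor, Function.update_self]
  rw [factor_update M c d η γ ω j j τ le_rfl]

/-- The total weight, at the arrival of `j`, of the estimators which arrive simultaneously and
precede `j`. -/
def tieWeight (M : MDP S A H) (c : ℕ → Table S A H) (d : ℕ → ℕ) (η γ : ℝ) {n : ℕ}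
    (ω : Fin n → Traj S A H) (j : Fin n) (x : Fin H × S × A) : ℝ :=
  ∑ i : Fin n with i < j ∧ (i : ℕ) + d i = j + d j,
    flat (iterate M c d η γ ω (j + d j)) x * flat (est M c d η γ ω i) x

/-- The number of estimators which arrive simultaneously with `j` and precede it. -/
def tieCount (d : ℕ → ℕ) {n : ℕ} (j : Fin n) : ℕ :=
  (Finset.univ.filter fun i : Fin n => i < j ∧ (i : ℕ) + d i = j + d j).card

lemma tieWeight_update (ω : Fin n → Traj S A H) (j : Fin n) (τ : Traj S A H) :
    tieWeight M c d η γ (Function.update ω j τ) j = tieWeight M c d η γ ω j := by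
  funext x
  refine Finset.sum_congr rfl fun i hi => ?_
  have hi := (Finset.mem_filter.1 hi).2
  rw [flat_est, flat_est, factor_update M c d η γ ω i j τ hi.2.le, Function.update_of_ne hi.1.ne,
    iterate_update M c d η γ ω τ le_rfl]

lemma adapted_tieWeight : ArrivalAdapted d fun (j : Fin n) (ω : Fin n → Traj S A H) =>
    tieWeight M c d η γ ω j := by
  intro j ω ω' h
  have h2 := adapted_iterate M c d η γ (m := fun j => j + d j) (fun j => le_rfl) j ω ω' h
  simp only at h2
  funext x
  refine Finset.sum_congr rfl fun i hi => ?_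
  have hi := (Finset.mem_filter.1 hi).2
  have h3 := adapted_factor M c d η γ i ω ω' fun k hk => h k <| by
    rcases hk with hk | hk
    · exact Or.inl (by omega)
    · exact Or.inr ⟨by omega, hk.2.trans hi.1.le⟩
  simp only at h3
  simp only [flat_est, h2, h3, h i (Or.inr ⟨hi.2, hi.1.le⟩)]

variable [Nonempty A]

lemma epExp_visit (ω : Fin n → Traj S A H) (j : Fin n) (g : Fin H × S × A → ℝ) :
    epExp M c d η γ ω j (fun τ => ∑ x, visit τ x * g x) =
      ∑ x, flat (occupancy M (policy M c d η γ ω j)) x * g x := by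
  simp only [epExp, sum_visit_mul]
  rw [sum_episode_mul_sum M _ fun h s a => g (h, s, a), sum_flat]
  rfl

variable {γ}

lemma factor_nonneg (hγ : 0 < γ) (hc : ∀ k < n, ∀ h s a, 0 ≤ c k h s a ∧ c k h s a ≤ 1)
    (ω : Fin n → Traj S A H) (j : Fin n) (x : Fin H × S × A) :
    0 ≤ factor M c d η γ ω j x := by
  have h1 := (iterate_isRegular M c d η γ ω j).nonneg x
  exact div_nonneg (hc j j.2 _ _ _).1 (add_nonneg (le_max_of_le_left h1) hγ.le)

lemma factor_le (hγ : 0 < γ) (hc : ∀ k < n, ∀ h s a, 0 ≤ c k h s a ∧ c k h s a ≤ 1)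
    (ω : Fin n → Traj S A H) (j : Fin n) (x : Fin H × S × A) :
    factor M c d η γ ω j x ≤ 1 / γ := by
  have h1 := (iterate_isRegular M c d η γ ω j).nonneg x
  refine div_le_div₀ zero_le_one (hc j j.2 _ _ _).2 hγ ?_
  linarith [le_max_of_le_left (b := flat (iterate M c d η γ ω j) x)
    (c := flat (iterate M c d η γ ω (j + d j)) x) h1]

/-- This is the purpose of the second entry of the maximum: weighted by the iterate that it updates,
the estimator stays below one, however far the iterates have moved since episode `j`. -/
lemma iterate_arrival_mul_factor_le (hγ : 0 < γ)
    (hc : ∀ k < n, ∀ h s a, 0 ≤ c k h s a ∧ c k h s a ≤ 1)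
    (ω : Fin n → Traj S A H) (j : Fin n) (x : Fin H × S × A) :
    flat (iterate M c d η γ ω (j + d j)) x * factor M c d η γ ω j x ≤ 1 := by
  have h1 := (iterate_isRegular M c d η γ ω j).nonneg x
  have h2 := (iterate_isRegular M c d η γ ω (j + d j)).nonneg x
  have h3 := le_max_right (flat (iterate M c d η γ ω j) x)
    (flat (iterate M c d η γ ω (j + d j)) x)
  have h4 : flat (c j) x ≤ 1 := (hc j j.2 _ _ _).2
  rw [factor, mul_div_assoc', div_le_one (by linarith)]
  nlinarith

lemma lateFactor_nonneg (hγ : 0 < γ) (hc : ∀ k < n, ∀ h s a, 0 ≤ c k h s a ∧ c k h s a ≤ 1)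
    (ω : Fin n → Traj S A H) (j : Fin n) (x : Fin H × S × A) :
    0 ≤ lateFactor M c d η γ ω j x := by
  unfold lateFactor
  split_ifs
  · exact le_rfl
  · exact factor_nonneg M c d η hγ hc ω j x

lemma lateFactor_le_factor (hγ : 0 < γ) (hc : ∀ k < n, ∀ h s a, 0 ≤ c k h s a ∧ c k h s a ≤ 1)
    (ω : Fin n → Traj S A H) (j : Fin n) (x : Fin H × S × A) :
    lateFactor M c d η γ ω j x ≤ factor M c d η γ ω j x := by
  unfold lateFactor
  split_ifs
  · exact factor_nonneg M c d η hγ hc ω j x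
  · exact le_rfl

lemma lateEst_nonneg (hγ : 0 < γ) (hc : ∀ k < n, ∀ h s a, 0 ≤ c k h s a ∧ c k h s a ≤ 1)
    (ω : Fin n → Traj S A H) (j : Fin n) (x : Fin H × S × A) :
    0 ≤ lateEst M c d η γ ω j x :=
  mul_nonneg (visit_nonneg _ _) (lateFactor_nonneg M c d η hγ hc ω j x)

/-- This is the purpose of the first entry of the maximum: in conditional mean the estimator never
exceeds the cost. For episode `0` it holds because the factor was set to zero. -/
lemma occupancy_mul_lateFactor_le (hγ : 0 < γ)
    (hc : ∀ k < n, ∀ h s a, 0 ≤ c k h s a ∧ c k h s a ≤ 1)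
    (ω : Fin n → Traj S A H) (j : Fin n) (x : Fin H × S × A) :
    flat (occupancy M (policy M c d η γ ω j)) x * lateFactor M c d η γ ω j x
      ≤ flat (c j) x := by
  have h4 : 0 ≤ flat (c j) x := (hc j j.2 _ _ _).1
  by_cases hj : (j : ℕ) = 0
  · simpa [lateFactor, hj] using h4
  · rw [lateFactor, if_neg hj, occupancy_policy M c d η γ ω (Nat.pos_of_ne_zero hj)]
    have h1 := (iterate_isRegular M c d η γ ω j).nonneg x
    have h3 := le_max_left (flat (iterate M c d η γ ω j) x)
      (flat (iterate M c d η γ ω (j + d j)) x)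
    rw [factor, mul_div_assoc', div_le_iff₀ (by linarith)]
    nlinarith

/-- The mass of one estimator has conditional mean at most `HSA` and range `H/γ`. -/
lemma sum_lateEst_tail (hγ : 0 < γ) (hH : 0 < H)
    (hc : ∀ k < n, ∀ h s a, 0 ≤ c k h s a ∧ c k h s a ≤ 1) {ε : ℝ} (hε : 0 < ε) :
    open Classical in
    ∑ ω : Fin n → Traj S A H with
      2 * (n * (H * Fintype.card S * Fintype.card A)) + H / γ * Real.log (1 / ε)
        < ∑ j, ∑ x, lateEst M c d η γ ω j x,
      (run M c d η γ n ω).toReal ≤ ε := by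
  classical
  have h := run_upper_tail M c d η γ (fun j ω => ∑ x, lateEst M c d η γ ω j x) ?_
    (fun _ => H * Fintype.card S * Fintype.card A) (R := H / γ) (by positivity)
    (fun j ω => Finset.sum_nonneg fun x _ => lateEst_nonneg M c d η hγ hc ω j x) ?_ ?_ hε
  · simpa using h
  · intro j ω ω' h
    have := adapted_lateEst M c d η γ j ω ω' h
    simp only at this
    simp only [this]
  · intro j ω
    rw [div_eq_mul_one_div]
    exact sum_visit_mul_le _ fun x => (lateFactor_le_factor M c d η hγ hc ω j x).trans
      (factor_le M c d η hγ hc ω j x)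
  · intro j ω
    simp only [lateEst_update, epExp_visit]
    refine (Finset.sum_le_sum fun x _ => (occupancy_mul_lateFactor_le M c d η hγ hc ω j x).trans
      (hc j j.2 _ _ _).2).trans (le_of_eq ?_)
    simp [mul_assoc]

/-- For the drift, with `w` the numbers of outstanding episodes. The tangent bound `√y ≤ s/2 +
y/(2s)` at `s = √(HSA)` takes the place of Jensen's inequality. -/
lemma sum_sqrt_lateEst_tail (hγ : 0 < γ) (hH : 0 < H)
    (hc : ∀ k < n, ∀ h s a, 0 ≤ c k h s a ∧ c k h s a ≤ 1) (w : Fin n → ℝ) {W : ℝ}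
    (hw : ∀ j, 0 ≤ w j) (hW : 0 < W) (hwW : ∀ j, w j ≤ W) {ε : ℝ} (hε : 0 < ε) :
    open Classical in
    ∑ ω : Fin n → Traj S A H with
      2 * ∑ j, w j * √(H * Fintype.card S * Fintype.card A)
        + W * √(H / γ) * Real.log (1 / ε)
        < ∑ j, w j * √(∑ x, lateEst M c d η γ ω j x),
      (run M c d η γ n ω).toReal ≤ ε := by
  classical
  have : Nonempty S := ⟨M.init⟩
  have hS : (0 : ℝ) < Fintype.card S := by exact_mod_cast Fintype.card_pos
  have hA : (0 : ℝ) < Fintype.card A := by exact_mod_cast Fintype.card_pos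
  have hH' : (0 : ℝ) < H := by exact_mod_cast hH
  have hs : 0 < √((H : ℝ) * Fintype.card S * Fintype.card A) := Real.sqrt_pos.2 (by positivity)
  refine run_upper_tail M c d η γ (fun j ω => w j * √(∑ x, lateEst M c d η γ ω j x)) ?_
    (fun j => w j * √(H * Fintype.card S * Fintype.card A)) (R := W * √(H / γ)) (by positivity)
    (fun j ω => mul_nonneg (hw j) (Real.sqrt_nonneg _)) ?_ ?_ hε
  · intro j ω ω' h
    have := adapted_lateEst M c d η γ j ω ω' h
    simp only at this
    simp only [this]
  · intro j ω
    refine mul_le_mul (hwW j) (Real.sqrt_le_sqrt ?_) (Real.sqrt_nonneg _) hW.le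
    rw [div_eq_mul_one_div]
    exact sum_visit_mul_le _ fun x => (lateFactor_le_factor M c d η hγ hc ω j x).trans
      (factor_le M c d η hγ hc ω j x)
  · intro j ω
    simp only [lateEst_update]
    simp only [mul_comm (w j), epExp_mul_const]
    refine mul_le_mul_of_nonneg_right ?_ (hw j)
    set s := √((H : ℝ) * Fintype.card S * Fintype.card A) with hsdef
    have hs2 : s ^ 2 = H * Fintype.card S * Fintype.card A := Real.sq_sqrt (by positivity)
    calc epExp M c d η γ ω j (fun τ => √(∑ x, visit τ x * lateFactor M c d η γ ω j x))
        ≤ epExp M c d η γ ω j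
            (fun τ => s / 2 + 1 / (2 * s) * ∑ x, visit τ x * lateFactor M c d η γ ω j x) := by
          refine epExp_mono M c d η γ ω j fun τ => ?_
          set y := ∑ x, visit τ x * lateFactor M c d η γ ω j x
          have hy : 0 ≤ y := Finset.sum_nonneg fun x _ =>
            mul_nonneg (visit_nonneg _ _) (lateFactor_nonneg M c d η hγ hc ω j x)
          have h1 : s / 2 + 1 / (2 * s) * y - √y = (s - √y) ^ 2 / (2 * s) := by
            have : y = √y ^ 2 := (Real.sq_sqrt hy).symm
            nth_rewrite 1 [this]
            field_simp
            ring
          have h2 : 0 ≤ (s - √y) ^ 2 / (2 * s) := by positivity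
          linarith
      _ ≤ s / 2 + 1 / (2 * s) * s ^ 2 := by
          rw [epExp_affine, epExp_visit]
          gcongr
          rw [hs2]
          refine (Finset.sum_le_sum fun x _ =>
            (occupancy_mul_lateFactor_le M c d η hγ hc ω j x).trans
            (hc j j.2 _ _ _).2).trans (le_of_eq ?_)
          simp [mul_assoc]
      _ = s := by field_simp; ring

lemma tieWeight_nonneg (hγ : 0 < γ) (hc : ∀ k < n, ∀ h s a, 0 ≤ c k h s a ∧ c k h s a ≤ 1)
    (ω : Fin n → Traj S A H) (j : Fin n) (x : Fin H × S × A) :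
    0 ≤ tieWeight M c d η γ ω j x := by
  refine Finset.sum_nonneg fun i _ => ?_
  rw [flat_est]
  exact mul_nonneg ((iterate_isRegular M c d η γ ω _).nonneg x)
    (mul_nonneg (visit_nonneg _ _) (factor_nonneg M c d η hγ hc ω i x))

lemma arrival_mul_est_le (hγ : 0 < γ) (hc : ∀ k < n, ∀ h s a, 0 ≤ c k h s a ∧ c k h s a ≤ 1)
    (ω : Fin n → Traj S A H) (i : Fin n) (x : Fin H × S × A) :
    flat (iterate M c d η γ ω (i + d i)) x * flat (est M c d η γ ω i) x ≤ visit (ω i) x := by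
  rw [flat_est, mul_left_comm]
  exact mul_le_of_le_one_right (visit_nonneg _ _)
    (iterate_arrival_mul_factor_le M c d η hγ hc ω i x)

lemma tieWeight_le (hγ : 0 < γ) (hc : ∀ k < n, ∀ h s a, 0 ≤ c k h s a ∧ c k h s a ≤ 1)
    (ω : Fin n → Traj S A H) (j : Fin n) (x : Fin H × S × A) :
    tieWeight M c d η γ ω j x ≤
      ∑ i : Fin n with i < j ∧ (i : ℕ) + d i = j + d j, visit (ω i) x := by
  refine Finset.sum_le_sum fun i hi => ?_
  rw [← (Finset.mem_filter.1 hi).2.2]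
  exact arrival_mul_est_le M c d η hγ hc ω i x

/-- In arrival order the earlier estimators of a tie are already known when `j` is averaged.
Weighted by the common iterate each of them is at most a visit, hence contributes at most `H` to the
conditional mean. -/
lemma sum_tie_tail (hγ : 0 < γ) (hH : 0 < H)
    (hc : ∀ k < n, ∀ h s a, 0 ≤ c k h s a ∧ c k h s a ≤ 1) {W : ℝ}
    (hW : 0 < W) (hwW : ∀ j : Fin n, (tieCount d j : ℝ) ≤ W) {ε : ℝ} (hε : 0 < ε) :
    open Classical in
    ∑ ω : Fin n → Traj S A H with
      2 * ∑ j : Fin n, (tieCount d j : ℝ) * H + H * (W * (1 / γ)) * Real.log (1 / ε)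
        < ∑ j, ∑ x, tieWeight M c d η γ ω j x * lateEst M c d η γ ω j x,
      (run M c d η γ n ω).toReal ≤ ε := by
  classical
  have hH' : (0 : ℝ) < H := by exact_mod_cast hH
  refine run_upper_tail M c d η γ
    (fun j ω => ∑ x, tieWeight M c d η γ ω j x * lateEst M c d η γ ω j x) ?_
    (fun j => (tieCount d j : ℝ) * H) (R := H * (W * (1 / γ))) (by positivity)
    (fun j ω => Finset.sum_nonneg fun x _ => mul_nonneg (tieWeight_nonneg M c d η hγ hc ω j x)
      (lateEst_nonneg M c d η hγ hc ω j x)) ?_ ?_ hε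
  · intro j ω ω' h
    have h1 := adapted_lateEst M c d η γ j ω ω' h
    have h2 := adapted_tieWeight M c d η γ j ω ω' h
    simp only at h1 h2
    simp only [h1, h2]
  · intro j ω
    simp only [lateEst, mul_left_comm (tieWeight _ _ _ _ _ _ _ _)]
    refine sum_visit_mul_le _ fun x => mul_le_mul ?_
      ((lateFactor_le_factor M c d η hγ hc ω j x).trans (factor_le M c d η hγ hc ω j x))
      (lateFactor_nonneg M c d η hγ hc ω j x) hW.le
    refine (tieWeight_le M c d η hγ hc ω j x).trans (le_trans ?_ (hwW j))
    exact (Finset.sum_le_sum fun i _ => visit_le_one _ _).trans (by simp [tieCount])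
  · intro j ω
    simp only [lateEst_update, tieWeight_update, mul_left_comm (tieWeight _ _ _ _ _ _ _ _),
      epExp_visit]
    calc ∑ x, flat (occupancy M (policy M c d η γ ω j)) x *
          (tieWeight M c d η γ ω j x * lateFactor M c d η γ ω j x)
        ≤ ∑ x, ∑ i : Fin n with i < j ∧ (i : ℕ) + d i = j + d j, visit (ω i) x := by
          refine Finset.sum_le_sum fun x _ => ?_
          rw [mul_left_comm]
          exact (mul_le_of_le_one_right (tieWeight_nonneg M c d η hγ hc ω j x)
            ((occupancy_mul_lateFactor_le M c d η hγ hc ω j x).trans (hc j j.2 _ _ _).2)).trans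
            (tieWeight_le M c d η hγ hc ω j x)
      _ ≤ tieCount d j * H := by
          rw [Finset.sum_comm]
          refine (Finset.sum_le_card_nsmul _ _ (H : ℝ) fun i _ => ?_).trans_eq
            (by rw [tieCount, nsmul_eq_mul])
          simpa using sum_visit_mul_le (ω i) (g := fun _ => 1) (B := 1) fun _ => le_rfl

/-- The weight `q^{j + d j}` reduces the range of the variables from `H/γ` to `H`, so the variance
term is `H²` per episode. -/
lemma arrival_lateEst_lower_tail (hγ : 0 < γ)
    (hc : ∀ k < n, ∀ h s a, 0 ≤ c k h s a ∧ c k h s a ≤ 1) {lam : ℝ} (hlam : 0 < lam)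
    {ε : ℝ} (hε : 0 < ε) :
    open Classical in
    ∑ ω : Fin n → Traj S A H with
      lam * (H : ℝ) ^ 2 / 2 * n + Real.log (1 / ε) / lam
        < ∑ j : Fin n, (∑ x, flat (occupancy M (policy M c d η γ ω j)) x *
            (flat (iterate M c d η γ ω (j + d j)) x * lateFactor M c d η γ ω j x)
          - ∑ x, visit (ω j) x *
            (flat (iterate M c d η γ ω (j + d j)) x * lateFactor M c d η γ ω j x)),
      (run M c d η γ n ω).toReal ≤ ε := by
  classical
  have hb : ∀ (j : Fin n) (ω : Fin n → Traj S A H) x,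
      flat (iterate M c d η γ ω (j + d j)) x * lateFactor M c d η γ ω j x ≤ 1 := fun j ω x =>
    (mul_le_mul_of_nonneg_left (lateFactor_le_factor M c d η hγ hc ω j x)
      ((iterate_isRegular M c d η γ ω _).nonneg x)).trans
      (iterate_arrival_mul_factor_le M c d η hγ hc ω j x)
  refine run_lower_tail M c d η γ (fun j ω => ∑ x, visit (ω j) x *
      (flat (iterate M c d η γ ω (j + d j)) x * lateFactor M c d η γ ω j x)) ?_
    (fun j ω => ∑ x, flat (occupancy M (policy M c d η γ ω j)) x *
            (flat (iterate M c d η γ ω (j + d j)) x * lateFactor M c d η γ ω j x)) ?_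
    hlam ?_ ?_ ?_ hε
  · intro j ω ω' h
    have h1 := adapted_lateFactor M c d η γ j ω ω' h
    have h2 := adapted_iterate M c d η γ (m := fun j => j + d j) (fun j => le_rfl) j ω ω' h
    simp only at h1 h2
    simp only [h1, h2, h j (Or.inr ⟨rfl, le_rfl⟩)]
  · intro j ω ω' h
    have h1 := adapted_lateFactor M c d η γ j ω ω' h
    have h2 := adapted_iterate M c d η γ (m := fun j => j + d j) (fun j => le_rfl) j ω ω' h
    have h3 := adapted_iterate M c d η γ (m := fun j => j) (fun j => Nat.le_add_right _ _) j ω ω' h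
    simp only at h1 h2 h3
    simp only [h1, h2, policy, h3]
  · exact fun j ω => Finset.sum_nonneg fun x _ => mul_nonneg (visit_nonneg _ _)
      (mul_nonneg ((iterate_isRegular M c d η γ ω _).nonneg x)
        (lateFactor_nonneg M c d η hγ hc ω j x))
  · intro j ω
    simpa using sum_visit_mul_le (ω j) (hb j ω)
  · intro j ω τ
    have h1 : ∀ τ, lateFactor M c d η γ (Function.update ω j τ) j
        = lateFactor M c d η γ ω j := by
      intro τ
      funext x
      rw [lateFactor, lateFactor, factor_update M c d η γ ω j j τ le_rfl]
    simp only [h1, iterate_update M c d η γ ω (j := j) _ (le_refl (j + d j)),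
      Function.update_self, epExp_visit, policy,
      iterate_update M c d η γ ω (j := j) _ (Nat.le_add_right (j : ℕ) (d j))]

/-- With `z = 2γv/m`, the inequality `2z/(z + 2) ≤ log (1 + z)` has left side `2γ v/(m + γv)`, and
`γv ≤ γ`. The bias `γ` in the denominator thus pays for all higher orders of the exponential. -/
lemma exp_implicit_exploration_le {m v : ℝ} (hγ : 0 < γ) (hm : 0 < m) (hv : 0 ≤ v)
    (hv1 : v ≤ 1) : Real.exp (2 * γ * (v / (m + γ))) - 1 ≤ 2 * γ * (v / m) := by
  have h1 := Real.le_log_one_add_of_nonneg (x := 2 * γ * (v / m)) (by positivity)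
  have h2 : 2 * γ * (v / (m + γ)) ≤ Real.log (1 + 2 * γ * (v / m)) := by
    refine le_trans ?_ h1
    have h3 : 2 * (2 * γ * (v / m)) / (2 * γ * (v / m) + 2) = 2 * γ * (v / (m + γ * v)) := by
      field_simp
      ring
    rw [h3]
    have h4 : γ * v ≤ γ := mul_le_of_le_one_right hγ.le hv1
    gcongr
  rw [Real.le_log_iff_exp_le (by positivity)] at h2
  linarith

lemma lateEst_upper_tail (hγ : 0 < γ)
    (hc : ∀ k < n, ∀ h s a, 0 ≤ c k h s a ∧ c k h s a ≤ 1) (x : Fin H × S × A)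
    {ε : ℝ} (hε : 0 < ε) :
    open Classical in
    ∑ ω : Fin n → Traj S A H with
      Real.log (1 / ε) / (2 * γ) < ∑ j : Fin n, (lateEst M c d η γ ω j x - flat (c j) x),
      (run M c d η γ n ω).toReal ≤ ε := by
  classical
  refine le_trans (le_of_eq (Finset.sum_congr (Finset.filter_congr fun ω _ => ?_) fun _ _ => rfl))
    (run_exp_tail M c d η γ
      (fun j ω => 2 * γ * lateEst M c d η γ ω j x - 2 * γ * flat (c j) x) ?_ ?_ hε)
  · simp only [← mul_sub, ← Finset.mul_sum]
    rw [div_lt_iff₀' (by positivity)]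
  · intro j ω ω' h
    have h1 := adapted_lateEst M c d η γ j ω ω' h
    simp only at h1
    simp only [h1]
  · intro j ω
    simp only [Real.exp_sub, div_eq_mul_inv, epExp_mul_const, lateEst_update]
    rw [← div_eq_mul_inv, div_le_one (Real.exp_pos _)]
    -- The visit is `0` or `1`, so its exponential is affine in it; the sum over `y` only matches
    -- the form of `epExp_visit`.
    have h1 : ∀ τ : Traj S A H, Real.exp (2 * γ * (visit τ x * lateFactor M c d η γ ω j x))
        = 1 + (Real.exp (2 * γ * lateFactor M c d η γ ω j x) - 1) *
          ∑ y, visit τ y * (if y = x then 1 else 0) := by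
      intro τ
      simp only [mul_ite, mul_one, mul_zero, Finset.sum_ite_eq', Finset.mem_univ, if_true]
      unfold visit
      split_ifs <;> simp
    simp only [h1]
    rw [epExp_affine, epExp_visit]
    simp only [mul_ite, mul_one, mul_zero, Finset.sum_ite_eq', Finset.mem_univ, if_true]
    refine le_trans ?_ (Real.add_one_le_exp _)
    rw [add_comm]
    refine add_le_add ?_ le_rfl
    have hc0 : 0 ≤ flat (c j) x := (hc j j.2 _ _ _).1
    have hc1 : flat (c j) x ≤ 1 := (hc j j.2 _ _ _).2
    by_cases hj : (j : ℕ) = 0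
    · simp only [lateFactor, hj, if_true, mul_zero, Real.exp_zero, sub_self, zero_mul]
      rw [hj] at hc0
      positivity
    · rw [lateFactor, if_neg hj, occupancy_policy M c d η γ ω (Nat.pos_of_ne_zero hj), factor]
      have h3 := (iterate_isRegular M c d η γ ω j).nonneg x
      set q := flat (iterate M c d η γ ω j) x
      set m := max q (flat (iterate M c d η γ ω (j + d j)) x)
      have hqm : q ≤ m := le_max_left _ _
      rcases h3.eq_or_lt with h0 | h0
      · rw [← h0, mul_zero]
        positivity
      · have hm := h0.trans_le hqm
        refine (mul_le_mul_of_nonneg_right (exp_implicit_exploration_le hγ hm hc0 hc1) h3).trans ?_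
        have h5 : flat (c j) x / m * q ≤ flat (c j) x := by
          rw [div_mul_eq_mul_div, div_le_iff₀ hm]
          gcongr
        calc 2 * γ * (flat (c j) x / m) * q = 2 * γ * (flat (c j) x / m * q) := by ring
          _ ≤ _ := by gcongr

end Estimators

end CostEstimators

/-! ### Squares of finite sums. -/

lemma sum_sq_eq_diag_add {n : ℕ} (v : Fin n → ℝ) :
    (∑ j, v j) ^ 2 = ∑ j, v j ^ 2 + 2 * ∑ j, ∑ i with i < j, v i * v j := by
  have h1 : ∀ i j : Fin n, v i * v j = (if i < j then v i * v j else 0)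
      + ((if i = j then v i * v j else 0) + (if j < i then v i * v j else 0)) := by
    intro i j
    rcases lt_trichotomy i j with h | h | h
    · simp [h, h.ne, h.not_gt]
    · simp [h]
    · simp [h, h.ne', h.not_gt]
  have h2 : ∑ j : Fin n, ∑ i : Fin n, (if j < i then v i * v j else 0) =
      ∑ j : Fin n, ∑ i : Fin n, (if i < j then v i * v j else 0) := by
    rw [Finset.sum_comm]
    exact Finset.sum_congr rfl fun i _ => Finset.sum_congr rfl fun j _ => by rw [mul_comm]
  rw [sq, Finset.sum_mul_sum, Finset.sum_comm]
  simp only [Finset.sum_filter]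
  rw [Finset.sum_congr rfl fun j _ => Finset.sum_congr rfl fun i _ => h1 i j]
  simp only [Finset.sum_add_distrib, h2, Finset.sum_ite_eq', Finset.mem_univ, if_true, sq]
  ring

/-- Minkowski's inequality in the Euclidean space weighted by `p`. -/
lemma sqrt_weighted_sum_sq_le {ι κ : Type*} [Fintype ι] (s : Finset κ) {p : ι → ℝ}
    (hp : ∀ x, 0 ≤ p x) (v : κ → ι → ℝ) :
    √(∑ x, p x * (∑ j ∈ s, v j x) ^ 2) ≤ ∑ j ∈ s, √(∑ x, p x * v j x ^ 2) := by
  have h : ∀ f : ι → ℝ, √(∑ x, p x * f x ^ 2) =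
      ‖(WithLp.toLp 2 (fun x => √(p x) * f x) : EuclideanSpace ℝ ι)‖ := by
    intro f
    rw [EuclideanSpace.norm_eq]
    congr 1
    refine Finset.sum_congr rfl fun x _ => ?_
    rw [Real.norm_eq_abs, sq_abs, mul_pow, Real.sq_sqrt (hp x)]
  simp only [h]
  refine le_trans (le_of_eq ?_) (norm_sum_le _ _)
  congr 1
  ext x
  simp [Finset.mul_sum]

/-! ### Counting outstanding and simultaneous feedback. -/

section Delays

variable {K : ℕ} (d : ℕ → ℕ)

/-- The number of episodes whose feedback is outstanding when the feedback of `j` arrives. -/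
def outstanding (j : Fin K) : ℕ :=
  (Finset.univ.filter fun k : Fin K => (k : ℕ) ≤ j + d j ∧ (j : ℕ) + d j < k + d k).card

lemma le_maxDelay (k : Fin K) : d k ≤ maxDelay d K :=
  Finset.le_sup (Finset.mem_range.2 k.2)

lemma card_fin_le_of_subset_Ico {p : Fin K → Prop} [DecidablePred p] {a b : ℕ}
    (h : ∀ k, p k → a ≤ (k : ℕ) ∧ (k : ℕ) < b) : (Finset.univ.filter p).card ≤ b - a := by
  rw [← Nat.card_Ico, ← Finset.card_map Fin.valEmbedding]
  refine Finset.card_le_card fun x hx => ?_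
  simp only [Finset.mem_map, Finset.mem_filter, Finset.mem_univ, true_and] at hx
  obtain ⟨k, hk, rfl⟩ := hx
  exact Finset.mem_Ico.2 (h k hk)

/-- With `m = j + d j`, an outstanding episode lies in `(m - d_max, m]`. -/
lemma outstanding_le (j : Fin K) : outstanding d j ≤ maxDelay d K := by
  refine (card_fin_le_of_subset_Ico (a := j + d j + 1 - maxDelay d K) (b := j + d j + 1)
    fun k hk => ?_).trans (by omega)
  have := le_maxDelay d k
  omega

lemma tieCount_le (j : Fin K) : tieCount d j ≤ maxDelay d K := by
  refine (card_fin_le_of_subset_Ico (a := (j : ℕ) - maxDelay d K) (b := j)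
    fun k hk => ?_).trans (by omega)
  have := le_maxDelay d k
  have := Fin.lt_def.1 hk.1
  omega

lemma sum_delay_eq : ∑ k : Fin K, d k = totalDelay d K := by
  rw [totalDelay, Finset.sum_range]

lemma sum_card_swap {p : Fin K → Fin K → Prop} [∀ i j, Decidable (p i j)] :
    ∑ j, (Finset.univ.filter fun i => p i j).card =
      ∑ i, (Finset.univ.filter fun j => p i j).card := by
  simp only [Finset.card_filter]
  exact Finset.sum_comm

/-- For fixed `i` its later partners `j` lie in `(i, i + d i]`, because `j ≤ j + d j = i + d i`. -/
lemma sum_tieCount_le : ∑ j : Fin K, tieCount d j ≤ totalDelay d K := by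
  rw [← sum_delay_eq]
  unfold tieCount
  rw [sum_card_swap]
  refine Finset.sum_le_sum fun i _ => ?_
  refine (card_fin_le_of_subset_Ico (a := i + 1) (b := i + d i + 1) fun k hk => ?_).trans
    (by omega)
  have := Fin.lt_def.1 hk.1
  omega

/-- Later episodes `k > j` are at most `d j` in number. Earlier ones satisfy `j < k + d k`, so after
exchanging the sums each `k` is counted at most `d k` times. -/
lemma sum_outstanding_le : ∑ j : Fin K, outstanding d j ≤ 2 * totalDelay d K := by
  have h1 : ∀ j : Fin K, outstanding d j ≤
      (Finset.univ.filter fun k : Fin K => (j : ℕ) < k ∧ (k : ℕ) ≤ j + d j).card +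
      (Finset.univ.filter fun k : Fin K => (k : ℕ) < j ∧ (j : ℕ) < k + d k).card := by
    intro j
    refine le_trans (Finset.card_le_card fun k hk => ?_) (Finset.card_union_le _ _)
    simp only [Finset.mem_filter, Finset.mem_univ, true_and, Finset.mem_union] at hk ⊢
    rcases lt_trichotomy (j : ℕ) k with h | h | h
    · exact Or.inl ⟨h, hk.1⟩
    · have : j = k := Fin.ext h
      subst this
      omega
    · exact Or.inr ⟨h, by omega⟩
  refine (Finset.sum_le_sum fun j _ => h1 j).trans ?_
  rw [Finset.sum_add_distrib, two_mul, ← sum_delay_eq]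
  refine add_le_add (Finset.sum_le_sum fun j _ => ?_) ?_
  · exact (card_fin_le_of_subset_Ico (a := j + 1) (b := j + d j + 1) fun k hk => by
      omega).trans (by omega)
  · rw [sum_card_swap (p := fun k j : Fin K => (k : ℕ) < j ∧ (j : ℕ) < k + d k)]
    refine Finset.sum_le_sum fun k _ => ?_
    exact (card_fin_le_of_subset_Ico (a := k + 1) (b := k + d k) fun j hj => by
      omega).trans (by omega)

end Delays

/-! ### Mirror descent regret, drift and the regret decomposition. -/

section Regret

variable {S A : Type*} {H : ℕ} [Fintype S] [Fintype A]
  (M : MDP S A H) (c : ℕ → Table S A H) (d : ℕ → ℕ) {η γ : ℝ} {n : ℕ}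

lemma value_le_horizon {k : ℕ} (hc : ∀ h s a, 0 ≤ c k h s a ∧ c k h s a ≤ 1)
    (π : Policy S A H) : value M π (c k) ≤ H := by
  rw [value_eq_pairing, pairing_eq_sum, ← (isFlow_occupancy M π).sum_flat_eq]
  exact Finset.sum_le_sum fun x _ =>
    mul_le_of_le_one_right ((isFlow_occupancy M π).flat_nonneg x) (hc _ _ _).2

lemma value_nonneg {k : ℕ} (hc : ∀ h s a, 0 ≤ c k h s a ∧ c k h s a ≤ 1)
    (π : Policy S A H) : 0 ≤ value M π (c k) := by
  rw [value_eq_pairing, pairing_eq_sum]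
  exact Finset.sum_nonneg fun x _ =>
    mul_nonneg ((isFlow_occupancy M π).flat_nonneg x) (hc _ _ _).1

lemma flat_arrived (ω : Fin n → Traj S A H) (m : ℕ) (x : Fin H × S × A) :
    flat (arrived M c d η γ ω m) x =
      ∑ j ∈ Finset.univ.filter (fun j : Fin n => (j : ℕ) + d j = m), flat (est M c d η γ ω j) x := by
  simp only [flat, arrived, Finset.sum_apply, Finset.sum_filter]
  refine Finset.sum_congr rfl fun j _ => ?_
  split_ifs <;> rfl

variable [Nonempty A]

lemma est_nonneg (hγ : 0 < γ) (hc : ∀ k < n, ∀ h s a, 0 ≤ c k h s a ∧ c k h s a ≤ 1)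
    (ω : Fin n → Traj S A H) (j : Fin n) (x : Fin H × S × A) :
    0 ≤ flat (est M c d η γ ω j) x := by
  rw [flat_est]
  exact mul_nonneg (visit_nonneg _ _) (factor_nonneg M c d η hγ hc ω j x)

lemma sum_est_le (hγ : 0 < γ) (hc : ∀ k < n, ∀ h s a, 0 ≤ c k h s a ∧ c k h s a ≤ 1)
    (ω : Fin n → Traj S A H) (j : Fin n) :
    ∑ x, flat (est M c d η γ ω j) x ≤ H / γ := by
  simp only [flat_est]
  rw [div_eq_mul_one_div]
  exact sum_visit_mul_le _ fun x => factor_le M c d η hγ hc ω j x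

lemma arrival_mul_est_sq_le (hγ : 0 < γ)
    (hc : ∀ k < n, ∀ h s a, 0 ≤ c k h s a ∧ c k h s a ≤ 1)
    (ω : Fin n → Traj S A H) (j : Fin n) (x : Fin H × S × A) :
    flat (iterate M c d η γ ω (j + d j)) x * flat (est M c d η γ ω j) x ^ 2 ≤
      flat (est M c d η γ ω j) x := by
  rw [sq, ← mul_assoc]
  exact mul_le_of_le_one_left (est_nonneg M c d hγ hc ω j x)
    ((arrival_mul_est_le M c d η hγ hc ω j x).trans (visit_le_one _ _))

lemma arrived_nonneg (hγ : 0 < γ) (hc : ∀ k < n, ∀ h s a, 0 ≤ c k h s a ∧ c k h s a ≤ 1)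
    (ω : Fin n → Traj S A H) (m : ℕ) (x : Fin H × S × A) :
    0 ≤ flat (arrived M c d η γ ω m) x := by
  rw [flat_arrived]
  exact Finset.sum_nonneg fun j _ => est_nonneg M c d hγ hc ω j x

lemma sum_range_arrival {N : ℕ} (hN : ∀ j : Fin n, (j : ℕ) + d j < N)
    (f : Fin n → ℕ → ℝ) :
    ∑ m ∈ Finset.range N, ∑ j ∈ Finset.univ.filter (fun j : Fin n => (j : ℕ) + d j = m), f j m
      = ∑ j : Fin n, f j (j + d j) := by
  simp only [Finset.sum_filter]
  rw [Finset.sum_comm]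
  refine Finset.sum_congr rfl fun j _ => ?_
  rw [Finset.sum_ite_eq, if_pos (Finset.mem_range.2 (hN j))]

/-- The local norm of the loss which enters the mirror descent step at the end of episode `m`. -/
def localNorm (η γ : ℝ) (ω : Fin n → Traj S A H) (m : ℕ) : ℝ :=
  ∑ x, flat (iterate M c d η γ ω m) x * flat (arrived M c d η γ ω m) x ^ 2

/-- The regret bound of mirror descent with respect to the estimated costs. -/
lemma mirror_regret (hη : 0 < η) (hγ : 0 < γ)
    (hc : ∀ k < n, ∀ h s a, 0 ≤ c k h s a ∧ c k h s a ≤ 1)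
    (ω : Fin n → Traj S A H) {N : ℕ} (hN : ∀ j : Fin n, (j : ℕ) + d j < N)
    {u : Table S A H} (hu : IsFlow M u) :
    η * ∑ j : Fin n, ∑ x, flat (est M c d η γ ω j) x *
        (flat (iterate M c d η γ ω (j + d j)) x - flat u x) ≤
      H * Real.log (Fintype.card S * Fintype.card A) +
        η ^ 2 / 2 * ∑ m ∈ Finset.range N, localNorm M c d η γ ω m := by
  have : Nonempty S := ⟨M.init⟩
  have hS : (0 : ℝ) < Fintype.card S := by exact_mod_cast Fintype.card_pos
  have hA : (0 : ℝ) < Fintype.card A := by exact_mod_cast Fintype.card_pos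
  let D : ℕ → ℝ := fun m => ∑ x, (flat u x * Real.log (flat u x / flat (iterate M c d η γ ω m) x)
    + flat (iterate M c d η γ ω m) x - flat u x)
  have hreg := iterate_isRegular M c d η γ ω
  have hstep : ∀ m, ∑ x, η * flat (arrived M c d η γ ω m) x *
      (flat (iterate M c d η γ ω m) x - flat u x) ≤
      D m - D (m + 1) + η ^ 2 / 2 * localNorm M c d η γ ω m := by
    intro m
    have h1 := mirror_step_le (l := fun x => η * flat (arrived M c d η γ ω m) x)
      (hreg m).nonneg (hreg (m + 1)).nonneg hu.flat_nonneg
      (fun x => mul_nonneg hη.le (arrived_nonneg M c d hγ hc ω m x))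
      ((hreg m).pos_of_flow (iterate_isFlow M c d η γ ω m.succ_pos))
      ((hreg (m + 1)).pos_of_flow hu) (by
        have := omdStep_variational η (arrived M c d η γ ω m) (hreg m) hu
        rwa [← iterate_succ] at this)
    refine h1.trans (le_of_eq ?_)
    simp only [D, localNorm, Finset.mul_sum]
    congr 1
    exact Finset.sum_congr rfl fun x _ => by ring
  have hsum := Finset.sum_le_sum fun m (_ : m ∈ Finset.range N) => hstep m
  rw [Finset.sum_add_distrib, Finset.sum_range_sub', ← Finset.mul_sum] at hsum
  have hDN : 0 ≤ D N := by
    refine Finset.sum_nonneg fun x _ => ?_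
    rcases ((hreg N).nonneg x).eq_or_lt with h0 | h0
    · have : flat u x = 0 := le_antisymm
        (not_lt.1 fun h => ((hreg N).pos_of_flow hu x h).ne h0) (hu.flat_nonneg x)
      simp [← h0, this]
    · have := entropy_tangent h0 h0 (hu.flat_nonneg x)
      rw [div_self h0.ne', Real.log_one] at this
      linarith
  -- The initial table is constant `1/(SA)` and has total mass `H`, as every flow has, so the linear
  -- terms of the divergence cancel.
  have hD0 : D 0 ≤ H * Real.log (Fintype.card S * Fintype.card A) := by
    have h1 : ∀ x, flat u x * Real.log (flat u x / flat (iterate M c d η γ ω 0) x)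
        ≤ flat u x * Real.log (Fintype.card S * Fintype.card A) := by
      intro x
      rcases (hu.flat_nonneg x).eq_or_lt with h0 | h0
      · simp [← h0]
      · refine mul_le_mul_of_nonneg_left ?_ h0.le
        rw [iterate_zero]
        simp only [flat, div_div_eq_mul_div, div_one]
        refine Real.log_le_log (mul_pos h0 (mul_pos hS hA)) ?_
        exact mul_le_of_le_one_left (by positivity) (hu.le_one _ _ _)
    have h2 : ∑ x : Fin H × S × A, flat (iterate M c d η γ ω 0) x = H := by
      rw [iterate_zero]
      simp only [flat, Finset.sum_const, Finset.card_univ, Fintype.card_prod, Fintype.card_fin,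
        nsmul_eq_mul, Nat.cast_mul]
      field_simp
    simp only [D, Finset.sum_sub_distrib, Finset.sum_add_distrib, h2, hu.sum_flat_eq]
    have h3 := Finset.sum_le_sum fun x (_ : x ∈ Finset.univ) => h1 x
    rw [← Finset.sum_mul, hu.sum_flat_eq] at h3
    linarith
  have hlhs : ∑ m ∈ Finset.range N, ∑ x, η * flat (arrived M c d η γ ω m) x *
      (flat (iterate M c d η γ ω m) x - flat u x) =
      η * ∑ j : Fin n, ∑ x, flat (est M c d η γ ω j) x *
        (flat (iterate M c d η γ ω (j + d j)) x - flat u x) := by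
    rw [← sum_range_arrival d hN (fun j m => ∑ x, flat (est M c d η γ ω j) x *
        (flat (iterate M c d η γ ω m) x - flat u x)), Finset.mul_sum]
    refine Finset.sum_congr rfl fun m _ => ?_
    rw [Finset.sum_comm, Finset.mul_sum]
    refine Finset.sum_congr rfl fun x _ => ?_
    rw [flat_arrived, ← Finset.sum_mul, mul_assoc]
  linarith

/-- The square of the simultaneous arrivals is expanded with `sum_sq_eq_diag_add`. On the diagonal
`q ĉ² ≤ ĉ`; the cross terms are ordered by index so that the earlier estimators form the predictable
`tieWeight`. Episode `0` has no predecessor and costs only `H/γ`. -/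
lemma sum_localNorm_le (hγ : 0 < γ) (hn : 0 < n)
    (hc : ∀ k < n, ∀ h s a, 0 ≤ c k h s a ∧ c k h s a ≤ 1)
    (ω : Fin n → Traj S A H) {N : ℕ} (hN : ∀ j : Fin n, (j : ℕ) + d j < N) :
    ∑ m ∈ Finset.range N, localNorm M c d η γ ω m ≤
      H / γ + ∑ j, ∑ x, lateEst M c d η γ ω j x +
        2 * ∑ j, ∑ x, tieWeight M c d η γ ω j x * lateEst M c d η γ ω j x := by
  have h1 : ∀ m, localNorm M c d η γ ω m =
      ∑ j ∈ Finset.univ.filter (fun j : Fin n => (j : ℕ) + d j = m),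
        ∑ x, (flat (iterate M c d η γ ω m) x * flat (est M c d η γ ω j) x ^ 2
          + 2 * (∑ i ∈ Finset.univ.filter (fun i : Fin n => i < j ∧ (i : ℕ) + d i = m),
            flat (iterate M c d η γ ω m) x * flat (est M c d η γ ω i) x)
              * flat (est M c d η γ ω j) x) := by
    intro m
    rw [localNorm, Finset.sum_comm]
    refine Finset.sum_congr rfl fun x _ => ?_
    rw [flat_arrived, Finset.sum_filter, sum_sq_eq_diag_add]
    rw [Finset.sum_filter, mul_add, Finset.mul_sum, Finset.mul_sum, Finset.mul_sum,
      ← Finset.sum_add_distrib]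
    refine Finset.sum_congr rfl fun j _ => ?_
    by_cases hj : (j : ℕ) + d j = m
    · simp only [if_pos hj]
      congr 1
      rw [mul_assoc 2, Finset.sum_mul, mul_left_comm, Finset.mul_sum]
      congr 1
      rw [← Finset.filter_filter, Finset.sum_filter (fun i : Fin n => (i : ℕ) + d i = m)]
      refine Finset.sum_congr rfl fun i _ => ?_
      split_ifs
      · ring
      · ring
    · simp [if_neg hj]
  simp only [h1]
  rw [sum_range_arrival d hN (fun j m =>
        ∑ x, (flat (iterate M c d η γ ω m) x * flat (est M c d η γ ω j) x ^ 2
          + 2 * (∑ i ∈ Finset.univ.filter (fun i : Fin n => i < j ∧ (i : ℕ) + d i = m),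
            flat (iterate M c d η γ ω m) x * flat (est M c d η γ ω i) x)
              * flat (est M c d η γ ω j) x))]
  let z : Fin n := ⟨0, hn⟩
  have h2 : ∀ j : Fin n,
      ∑ x, (flat (iterate M c d η γ ω (j + d j)) x * flat (est M c d η γ ω j) x ^ 2
          + 2 * (∑ i ∈ Finset.univ.filter (fun i : Fin n => i < j ∧ (i : ℕ) + d i = j + d j),
            flat (iterate M c d η γ ω (j + d j)) x * flat (est M c d η γ ω i) x)
              * flat (est M c d η γ ω j) x) ≤
      (if j = z then H / γ else 0) + ∑ x, lateEst M c d η γ ω j x +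
        2 * ∑ x, tieWeight M c d η γ ω j x * lateEst M c d η γ ω j x := by
    intro j
    have h3 : ∑ x, (flat (iterate M c d η γ ω (j + d j)) x * flat (est M c d η γ ω j) x ^ 2
          + 2 * (∑ i ∈ Finset.univ.filter (fun i : Fin n => i < j ∧ (i : ℕ) + d i = j + d j),
            flat (iterate M c d η γ ω (j + d j)) x * flat (est M c d η γ ω i) x)
              * flat (est M c d η γ ω j) x) ≤
        ∑ x, flat (est M c d η γ ω j) x +
          2 * ∑ x, tieWeight M c d η γ ω j x * flat (est M c d η γ ω j) x := by
      rw [Finset.mul_sum, ← Finset.sum_add_distrib]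
      refine Finset.sum_le_sum fun x _ => ?_
      have := arrival_mul_est_sq_le M c d (η := η) hγ hc ω j x
      rw [tieWeight, mul_assoc 2]
      linarith
    refine h3.trans ?_
    by_cases hj : j = z
    · have h4 := sum_est_le M c d (η := η) hγ hc ω j
      have h5 : ∀ x, lateEst M c d η γ ω j x = 0 := by
        intro x
        rw [lateEst, lateFactor, if_pos (by rw [hj]), mul_zero]
      have h6 : ∀ x, tieWeight M c d η γ ω j x = 0 := by
        intro x
        refine Finset.sum_eq_zero fun i hi => ?_
        have := Fin.lt_def.1 (Finset.mem_filter.1 hi).2.1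
        rw [hj] at this
        exact absurd this (Nat.not_lt_zero _)
      simp only [h5, h6, if_pos hj, zero_mul, Finset.sum_const_zero, mul_zero, add_zero]
      exact h4
    · have hj0 : (j : ℕ) ≠ 0 := fun h => hj (Fin.ext h)
      simp only [flat_est_eq_lateEst M c d η γ ω hj0, if_neg hj, zero_add, le_refl]
  refine (Finset.sum_le_sum fun j _ => h2 j).trans (le_of_eq ?_)
  rw [Finset.sum_add_distrib, Finset.sum_add_distrib, Finset.mul_sum, Finset.sum_ite_eq',
    if_pos (Finset.mem_univ z)]

/-- The old iterate itself serves as comparator in the optimality condition, which excludes `m = 0`.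
Minkowski's inequality separates simultaneous arrivals. -/
lemma iterate_stability (hη : 0 < η) (hγ : 0 < γ)
    (hc : ∀ k < n, ∀ h s a, 0 ≤ c k h s a ∧ c k h s a ≤ 1)
    (ω : Fin n → Traj S A H) {m : ℕ} (hm : 0 < m) :
    ∑ x, |flat (iterate M c d η γ ω m) x - flat (iterate M c d η γ ω (m + 1)) x| ≤
      η * √(2 * H) * ∑ j ∈ Finset.univ.filter (fun j : Fin n => (j : ℕ) + d j = m),
        √(∑ x, flat (est M c d η γ ω j) x) := by
  have hreg := iterate_isRegular M c d η γ ω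
  have hf := iterate_isFlow M c d η γ ω hm
  have hf' := iterate_isFlow M c d η γ ω m.succ_pos
  have h1 := mirror_step_stability (l := fun x => η * flat (arrived M c d η γ ω m) x)
      (m := H) (hreg m).nonneg (hreg (m + 1)).nonneg
      (fun x => mul_nonneg hη.le (arrived_nonneg M c d hγ hc ω m x))
      ((hreg m).pos_of_flow hf') ((hreg (m + 1)).pos_of_flow hf) hf.sum_flat_eq hf'.sum_flat_eq
      (by
        have := omdStep_variational η (arrived M c d η γ ω m) (hreg m) hf
        rwa [← iterate_succ] at this)
  refine h1.trans ?_
  have h2 : 2 * (H : ℝ) * ∑ x, flat (iterate M c d η γ ω m) x *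
      (η * flat (arrived M c d η γ ω m) x) ^ 2 =
      η ^ 2 * ((2 * H) * ∑ x, flat (iterate M c d η γ ω m) x *
        flat (arrived M c d η γ ω m) x ^ 2) := by
    simp only [Finset.mul_sum]
    exact Finset.sum_congr rfl fun x _ => by ring
  rw [h2, Real.sqrt_mul (sq_nonneg η), Real.sqrt_sq hη.le, Real.sqrt_mul (by positivity),
    mul_assoc]
  simp only [flat_arrived]
  gcongr
  refine (sqrt_weighted_sum_sq_le _ (hreg m).nonneg _).trans ?_
  refine Finset.sum_le_sum fun j hj => Real.sqrt_le_sqrt (Finset.sum_le_sum fun x _ => ?_)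
  rw [← (Finset.mem_filter.1 hj).2]
  exact arrival_mul_est_sq_le M c d hγ hc ω j x

/-- The total drift of the iterates between the episodes and the arrivals of their feedback. -/
lemma sum_drift_le (hη : 0 < η) (hγ : 0 < γ) (hn : 0 < n)
    (hc : ∀ k < n, ∀ h s a, 0 ≤ c k h s a ∧ c k h s a ≤ 1) (ω : Fin n → Traj S A H) :
    ∑ k ∈ Finset.univ.filter (fun k : Fin n => (k : ℕ) ≠ 0), ∑ x, |flat (iterate M c d η γ ω k) x
        - flat (iterate M c d η γ ω (k + d k)) x| ≤
      η * √(2 * H) * (maxDelay d n * √(H / γ)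
        + ∑ j : Fin n, outstanding d j * √(∑ x, lateEst M c d η γ ω j x)) := by
  have h1 : ∀ k : Fin n, (k : ℕ) ≠ 0 → ∑ x, |flat (iterate M c d η γ ω k) x
        - flat (iterate M c d η γ ω (k + d k)) x| ≤
      ∑ j : Fin n, if (k : ℕ) ≤ j + d j ∧ (j : ℕ) + d j < k + d k then
        η * √(2 * H) * √(∑ x, flat (est M c d η γ ω j) x) else 0 := by
    intro k hk
    have h2 : ∀ x, |flat (iterate M c d η γ ω k) x - flat (iterate M c d η γ ω (k + d k)) x| ≤
        ∑ m ∈ Finset.Ico (k : ℕ) (k + d k),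
          |flat (iterate M c d η γ ω m) x - flat (iterate M c d η γ ω (m + 1)) x| := by
      intro x
      have := dist_le_Ico_sum_dist (fun m => flat (iterate M c d η γ ω m) x)
        (Nat.le_add_right (k : ℕ) (d k))
      simpa only [Real.dist_eq] using this
    refine (Finset.sum_le_sum fun x _ => h2 x).trans ?_
    rw [Finset.sum_comm]
    refine (Finset.sum_le_sum fun m hm => iterate_stability M c d hη hγ hc ω
      (lt_of_lt_of_le (Nat.pos_of_ne_zero hk) (Finset.mem_Ico.1 hm).1)).trans (le_of_eq ?_)
    -- Reorganize by arrivals: the step caused by `j` lies on the path from `q^k` to `q^{k + d k}`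
    -- exactly when `k` is outstanding at `j + d j`.
    simp only [Finset.mul_sum, Finset.sum_filter]
    rw [Finset.sum_comm]
    refine Finset.sum_congr rfl fun j _ => ?_
    rw [← Finset.mul_sum, Finset.sum_ite_eq, mul_ite, mul_zero]
    simp only [Finset.mem_Ico]
  have h3 : ∑ k ∈ Finset.univ.filter (fun k : Fin n => (k : ℕ) ≠ 0), ∑ x, |flat (iterate M c d η γ ω k) x
        - flat (iterate M c d η γ ω (k + d k)) x| ≤
      ∑ k : Fin n, ∑ j : Fin n, if (k : ℕ) ≤ j + d j ∧ (j : ℕ) + d j < k + d k then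
        η * √(2 * H) * √(∑ x, flat (est M c d η γ ω j) x) else 0 := by
    refine (Finset.sum_le_sum fun k hk => h1 k (Finset.mem_filter.1 hk).2).trans
      (Finset.sum_le_sum_of_subset_of_nonneg (Finset.filter_subset _ _) fun k _ _ =>
        Finset.sum_nonneg fun j _ => ?_)
    split_ifs <;> positivity
  refine h3.trans ?_
  rw [Finset.sum_comm]
  let z : Fin n := ⟨0, hn⟩
  have h4 : ∀ j : Fin n, (∑ k : Fin n, if (k : ℕ) ≤ j + d j ∧ (j : ℕ) + d j < k + d k then
        η * √(2 * H) * √(∑ x, flat (est M c d η γ ω j) x) else 0) ≤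
      η * √(2 * H) * ((if j = z then maxDelay d n * √(H / γ) else 0) +
        outstanding d j * √(∑ x, lateEst M c d η γ ω j x)) := by
    intro j
    rw [← Finset.sum_filter, Finset.sum_const, nsmul_eq_mul, mul_left_comm]
    change η * √(2 * H) * (outstanding d j * _) ≤ _
    gcongr
    by_cases hj : j = z
    · rw [if_pos hj]
      refine le_add_of_le_of_nonneg ?_ (by positivity)
      gcongr
      · exact outstanding_le d j
      · exact sum_est_le M c d hγ hc ω j
    · have hj0 : (j : ℕ) ≠ 0 := fun h => hj (Fin.ext h)
      simp only [flat_est_eq_lateEst M c d η γ ω hj0, if_neg hj, zero_add, le_refl]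
  refine (Finset.sum_le_sum fun j _ => h4 j).trans (le_of_eq ?_)
  rw [← Finset.mul_sum, Finset.sum_add_distrib, Finset.sum_ite_eq', if_pos (Finset.mem_univ z)]

/-- The bias of the estimator is controlled by the drift. -/
lemma arrival_mul_bias_le {q r v g : ℝ} (hq : 0 ≤ q) (hr : 0 ≤ r) (hv : 0 ≤ v) (hv1 : v ≤ 1)
    (hg : 0 < g) : r * v ≤ |q - r| + g + q * (r * (v / (max q r + g))) := by
  have h1 : r ≤ max q r := le_max_right _ _
  have h2 : q ≤ max q r := le_max_left _ _
  have hm : 0 < max q r + g := by linarith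
  have h3 : max q r - q ≤ |q - r| := by
    rcases le_total q r with h | h
    · rw [max_eq_right h, abs_sub_comm]; exact le_abs_self _
    · rw [max_eq_left h, sub_self]; exact abs_nonneg _
  have h4 : r * v - q * (r * (v / (max q r + g)))
      = (r / (max q r + g)) * v * (max q r - q + g) := by field_simp; ring
  have h5 : (r / (max q r + g)) * v ≤ 1 := by
    refine mul_le_one₀ ?_ hv hv1
    rw [div_le_one hm]
    linarith
  have h6 : (r / (max q r + g)) * v * (max q r - q + g) ≤ max q r - q + g :=
    mul_le_of_le_one_left (by linarith) h5
  linarith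

/-- The regret decomposition on the event where the estimators concentrate. -/
lemma regret_decomposition (hη : 0 < η) (hγ : 0 < γ) (hn : 0 < n)
    (hc : ∀ k < n, ∀ h s a, 0 ≤ c k h s a ∧ c k h s a ≤ 1)
    (ω : Fin n → Traj S A H) {N : ℕ} (hN : ∀ j : Fin n, (j : ℕ) + d j < N)
    (π' : Policy S A H) {lower upper : ℝ}
    (hlower : ∑ j : Fin n, (∑ x, flat (occupancy M (policy M c d η γ ω j)) x *
            (flat (iterate M c d η γ ω (j + d j)) x * lateFactor M c d η γ ω j x)
          - ∑ x, visit (ω j) x *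
            (flat (iterate M c d η γ ω (j + d j)) x * lateFactor M c d η γ ω j x)) ≤ lower)
    (hupper : ∀ x, ∑ j : Fin n, (lateEst M c d η γ ω j x - flat (c j) x) ≤ upper) :
    ∑ k : Fin n, value M (policy M c d η γ ω k) (c k) - ∑ k : Fin n, value M π' (c k) ≤
      H + H / γ + 2 * ∑ k ∈ Finset.univ.filter (fun k : Fin n => (k : ℕ) ≠ 0), ∑ x, |flat (iterate M c d η γ ω k) x
        - flat (iterate M c d η γ ω (k + d k)) x|
      + n * (γ * (H * Fintype.card S * Fintype.card A)) + lower
      + (H * Real.log (Fintype.card S * Fintype.card A) / η +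
        η / 2 * ∑ m ∈ Finset.range N, localNorm M c d η γ ω m) + H * upper := by
  set u := occupancy M π' with hu_def
  have hu : IsFlow M u := isFlow_occupancy M π'
  let z : Fin n := ⟨0, hn⟩
  let q : ℕ → Fin H × S × A → ℝ := fun m => flat (iterate M c d η γ ω m)
  have hq : ∀ m x, 0 ≤ q m x := fun m => (iterate_isRegular M c d η γ ω m).nonneg
  let e : Fin n → Fin H × S × A → ℝ := lateEst M c d η γ ω
  let dr : Fin n → ℝ := fun k => ∑ x, |q k x - q (k + d k) x|
  have hcard : ∑ _x : Fin H × S × A, γ = γ * (H * Fintype.card S * Fintype.card A) := by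
    simp only [Finset.sum_const, Finset.card_univ, Fintype.card_prod, Fintype.card_fin,
        nsmul_eq_mul, Nat.cast_mul]
    ring
  -- The drift is paid twice: for replacing `q^k` by `q^{k + d k}`, and for the bias due to the
  -- maximum in the denominator. Episode `0` is charged its maximal value `H`.
  have hvalue : ∀ k : Fin n, value M (policy M c d η γ ω k) (c k) ≤
      (if k = z then (H : ℝ) else 0) + (if (k : ℕ) ≠ 0 then 2 * dr k else 0)
        + γ * (H * Fintype.card S * Fintype.card A)
        + ∑ x, flat (occupancy M (policy M c d η γ ω k)) x *
            (q (k + d k) x * lateFactor M c d η γ ω k x) := by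
    intro k
    by_cases hk : k = z
    · have hk0 : (k : ℕ) = 0 := by rw [hk]
      have h1 := value_le_horizon M c (hc k k.2) (policy M c d η γ ω k)
      have h2 : ∑ x, flat (occupancy M (policy M c d η γ ω k)) x *
            (q (k + d k) x * lateFactor M c d η γ ω k x) = 0 :=
        Finset.sum_eq_zero fun x _ => by rw [lateFactor, if_pos hk0]; ring
      rw [if_pos hk, if_neg (not_not.2 hk0), h2]
      have : 0 ≤ γ * (H * Fintype.card S * Fintype.card A) := by positivity
      linarith
    · have hk0 : (k : ℕ) ≠ 0 := fun h => hk (Fin.ext h)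
      rw [if_neg hk, if_pos hk0, value_eq_pairing, pairing_eq_sum,
        occupancy_policy M c d η γ ω (Nat.pos_of_ne_zero hk0), zero_add, ← hcard, Finset.mul_sum,
        ← Finset.sum_add_distrib, ← Finset.sum_add_distrib]
      refine Finset.sum_le_sum fun x _ => ?_
      have hc0 : 0 ≤ flat (c k) x := (hc k k.2 _ _ _).1
      have hc1 : flat (c k) x ≤ 1 := (hc k k.2 _ _ _).2
      have h1 := arrival_mul_bias_le (hq k x) (hq (k + d k) x) hc0 hc1 hγ
      have h2 : (q k x - q (k + d k) x) * flat (c k) x ≤ |q k x - q (k + d k) x| :=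
        (mul_le_mul_of_nonneg_right (le_abs_self _) hc0).trans
          (mul_le_of_le_one_right (abs_nonneg _) hc1)
      rw [lateFactor, if_neg hk0, factor]
      change q k x * _ ≤ 2 * |q k x - q (k + d k) x| + γ
        + q k x * (q (k + d k) x * (flat (c k) x / (max (q k x) (q (k + d k) x) + γ)))
      linarith
  have hsum1 := Finset.sum_le_sum fun k (_ : k ∈ Finset.univ) => hvalue k
  simp only [Finset.sum_add_distrib, Finset.sum_ite_eq', Finset.mem_univ, if_true,
    ← Finset.sum_filter, ← Finset.mul_sum, Finset.sum_const, Finset.card_univ, Fintype.card_fin,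
    nsmul_eq_mul] at hsum1
  rw [Finset.sum_sub_distrib] at hlower
  -- Episode `0` is put back here, since mirror descent processes its estimator like the others.
  have hlate : ∑ j : Fin n, ∑ x, visit (ω j) x * (q (j + d j) x * lateFactor M c d η γ ω j x) ≤
      ∑ j : Fin n, ∑ x, flat (est M c d η γ ω j) x * q (j + d j) x := by
    refine Finset.sum_le_sum fun j _ => Finset.sum_le_sum fun x _ => ?_
    rw [flat_est, mul_assoc, mul_comm (q _ x)]
    exact mul_le_mul_of_nonneg_left (mul_le_mul_of_nonneg_right
      (lateFactor_le_factor M c d η hγ hc ω j x) (hq _ x)) (visit_nonneg _ _)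
  have homd := mirror_regret M c d hη hγ hc ω hN hu
  have homd' : ∑ j : Fin n, ∑ x, flat (est M c d η γ ω j) x * q (j + d j) x ≤
      ∑ j : Fin n, ∑ x, flat (est M c d η γ ω j) x * flat u x +
      (H * Real.log (Fintype.card S * Fintype.card A) / η +
        η / 2 * ∑ m ∈ Finset.range N, localNorm M c d η γ ω m) := by
    rw [← le_div_iff₀' hη] at homd
    simp only [mul_sub, Finset.sum_sub_distrib] at homd
    have h1 : (H * Real.log (Fintype.card S * Fintype.card A) +
        η ^ 2 / 2 * ∑ m ∈ Finset.range N, localNorm M c d η γ ω m) / η =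
        H * Real.log (Fintype.card S * Fintype.card A) / η +
        η / 2 * ∑ m ∈ Finset.range N, localNorm M c d η γ ω m := by
      field_simp
    rw [h1] at homd
    linarith
  -- On the comparator side it is removed again, at cost `H/γ`, because the upper tail concerns only
  -- later episodes.
  have hcomp : ∑ j : Fin n, ∑ x, flat (est M c d η γ ω j) x * flat u x ≤
      H / γ + ∑ j : Fin n, ∑ x, e j x * flat u x := by
    have h1 : ∀ j : Fin n, ∑ x, flat (est M c d η γ ω j) x * flat u x ≤
        (if j = z then H / γ else 0) + ∑ x, e j x * flat u x := by
      intro j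
      by_cases hj : j = z
      · rw [if_pos hj]
        refine le_add_of_le_of_nonneg ?_ (Finset.sum_nonneg fun x _ =>
          mul_nonneg (lateEst_nonneg M c d η hγ hc ω j x) (hu.flat_nonneg x))
        exact (Finset.sum_le_sum fun x _ => mul_le_of_le_one_right
          (est_nonneg M c d hγ hc ω j x) (hu.le_one _ _ _)).trans (sum_est_le M c d hγ hc ω j)
      · have hj0 : (j : ℕ) ≠ 0 := fun h => hj (Fin.ext h)
        simp only [flat_est_eq_lateEst M c d η γ ω hj0, if_neg hj, zero_add, e, le_refl]
    refine (Finset.sum_le_sum fun j _ => h1 j).trans (le_of_eq ?_)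
    rw [Finset.sum_add_distrib, Finset.sum_ite_eq', if_pos (Finset.mem_univ z)]
  have hneu : ∑ j : Fin n, ∑ x, e j x * flat u x ≤
      ∑ k : Fin n, value M π' (c k) + H * upper := by
    simp only [value_eq_pairing, pairing_eq_sum]
    rw [Finset.sum_comm, Finset.sum_comm (f := fun (k : Fin n) x => _ * flat (c k) x),
      ← hu.sum_flat_eq, Finset.sum_mul, ← Finset.sum_add_distrib]
    refine Finset.sum_le_sum fun x _ => ?_
    have h1 := mul_le_mul_of_nonneg_left (hupper x) (hu.flat_nonneg x)
    rw [Finset.sum_sub_distrib, mul_sub] at h1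
    rw [← Finset.sum_mul, ← Finset.mul_sum, mul_comm]
    simp only [e, ← hu_def]
    linarith
  simp only [dr, q] at *
  linarith

end Regret

/-! ### The union bound and the arithmetic of the parameters. -/

lemma le_toOuterMeasure_of_bad_events {Ω ι : Type*} [Fintype Ω] [Fintype ι] (p : PMF Ω)
    (E : Set Ω) (F : ι → Finset Ω) {δ : ℝ} (hF : ∑ i, ∑ ω ∈ F i, (p ω).toReal ≤ δ)
    (hE : ∀ ω, (∀ i, ω ∉ F i) → ω ∈ E) : ENNReal.ofReal (1 - δ) ≤ p.toOuterMeasure E := by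
  classical
  have htop : ∀ ω, E.indicator p ω ≠ ⊤ := fun ω => by
    by_cases h : ω ∈ E <;> simp [h, p.apply_ne_top]
  rw [PMF.toOuterMeasure_apply, tsum_fintype, ENNReal.ofReal_le_iff_le_toReal
    (ENNReal.sum_ne_top.2 fun ω _ => htop ω), ENNReal.toReal_sum fun ω _ => htop ω]
  have h1 : ∀ ω, (p ω).toReal ≤ (E.indicator p ω).toReal
      + ∑ i, if ω ∈ F i then (p ω).toReal else 0 := by
    intro ω
    have hnn : ∀ i, 0 ≤ if ω ∈ F i then (p ω).toReal else 0 := fun i => by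
      split_ifs <;> simp
    by_cases h : ω ∈ E
    · rw [Set.indicator_of_mem h]
      exact le_add_of_nonneg_right (Finset.sum_nonneg fun i _ => hnn i)
    · obtain ⟨i, hi⟩ : ∃ i, ω ∈ F i := by
        by_contra hcon
        exact h (hE ω (not_exists.1 hcon))
      rw [Set.indicator_of_notMem h, ENNReal.toReal_zero, zero_add]
      refine le_trans (le_of_eq (if_pos hi).symm)
        (Finset.single_le_sum (fun i _ => hnn i) (Finset.mem_univ i))
  have h2 := Finset.sum_le_sum fun ω (_ : ω ∈ Finset.univ) => h1 ω
  rw [sum_toReal_pmf, Finset.sum_add_distrib, Finset.sum_comm] at h2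
  simp only [Finset.sum_ite_mem, Finset.univ_inter] at h2
  linarith

lemma exists_bad_event {Ω : Type*} [Fintype Ω] {p f : Ω → ℝ} {b ε : ℝ}
    (h : open Classical in ∑ ω with b < f ω, p ω ≤ ε) :
    ∃ F : Finset Ω, ∑ ω ∈ F, p ω ≤ ε ∧ ∀ ω, ω ∉ F → f ω ≤ b := by
  classical
  exact ⟨_, h, fun ω hω => not_lt.1 fun hlt => hω (by simpa using hlt)⟩

/-- The arithmetic of the regret bound, in terms of `P = √(SAK L)`, `Q = (HSA)^{1/4} √(D L)` and
`T = √H d_max log (H / δ)`. -/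
lemma total_bound_le {H η K D dm sa L l lsa P Q T ws drift X : ℝ} (hH : 0 < H) (hη : 0 < η)
    (hη1 : η ≤ 1) (hD : 0 ≤ D) (hdm : 0 ≤ dm) (hsa : 1 ≤ sa) (hL : 1 / 2 ≤ L)
    (hl1 : 1 ≤ l) (hl : l ≤ 4 * L) (hlsa : lsa ≤ L) (hK : 0 ≤ K) (hT0 : 0 ≤ T)
    (hηK : η * (sa * K) ≤ P) (hLη : L / η ≤ P + Q) (hηD : η * √sa * D ≤ Q) (hLP : L ≤ P)
    (hdml : dm * l ≤ 3 * Q + 3 * T)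
    (hws : ws ≤ 2 * (2 * D * √(H * sa)) + (dm + 1) * √(H / η) * l)
    (hdrift : drift ≤ η * √(2 * H) * (dm * √(H / η) + ws))
    (hX : X ≤ H / η + (2 * (K * (H * sa)) + H / η * l)
      + 2 * (2 * (D * H) + H * ((dm + 1) * (1 / η)) * l)) :
    H + H / η + 2 * drift + K * (η * (H * sa)) + (η / H * H ^ 2 / 2 * K + l / (η / H))
      + (H * lsa / η + η / 2 * X) + H * ((l + L) / (2 * η)) ≤
      100 * (H * P + Q * H + H * T) := by
  -- The range `√(H/η)` of the square-root estimators loses its `η` against the step size, so the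
  -- maximal delay enters without a factor `1/η`.
  have hsq : √(2 * H) * √(H / η) * η ≤ 2 * H := by
    rw [← Real.sqrt_mul (by positivity)]
    have h1 : √(2 * H * (H / η)) * η = √(2 * η) * H := by
      rw [← Real.sqrt_sq hη.le, ← Real.sqrt_sq hH.le, ← Real.sqrt_mul (by positivity),
        ← Real.sqrt_mul (by positivity)]
      congr 1
      simp only [Real.sqrt_sq hη.le, Real.sqrt_sq hH.le]
      field_simp
    rw [h1]
    have h2 : √(2 * η) ≤ 2 := by
      rw [Real.sqrt_le_left (by norm_num)]
      linarith
    gcongr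
  have hsq2 : √(2 * H) * √(H * sa) ≤ 2 * H * √sa := by
    rw [← Real.sqrt_mul (by positivity)]
    refine Real.sqrt_le_iff.2 ⟨by positivity, ?_⟩
    rw [mul_pow, Real.sq_sqrt (by linarith)]
    have : 0 ≤ H ^ 2 * sa := by positivity
    nlinarith
  have hsa1 : 1 ≤ √sa := Real.one_le_sqrt.2 hsa
  have hηD' : η * D ≤ Q := by
    refine le_trans ?_ hηD
    have : 0 ≤ η * D := by positivity
    nlinarith
  have hQ : 0 ≤ Q := le_trans (by positivity) hηD'
  have hηK' : η * K ≤ P := by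
    refine le_trans ?_ hηK
    have : 0 ≤ η * K := by positivity
    nlinarith
  have hlη : l / η ≤ 4 * (P + Q) := by
    calc l / η ≤ 4 * L / η := by gcongr
      _ = 4 * (L / η) := by ring
      _ ≤ _ := by linarith
  have h1η : 1 / η ≤ 2 * (P + Q) := by
    calc 1 / η ≤ 2 * L / η := by gcongr; linarith
      _ = 2 * (L / η) := by ring
      _ ≤ _ := by linarith
  have hlsaη : lsa / η ≤ P + Q := le_trans (by gcongr) hLη
  have hWl : (dm + 1) * l ≤ 3 * Q + 3 * T + 4 * P := by linarith
  have hdm1 : dm ≤ 3 * Q + 3 * T := le_trans (le_mul_of_one_le_right hdm hl1) hdml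
  have hdrift' : drift ≤ H * (2 * (3 * Q + 3 * T) + 8 * Q + 2 * (3 * Q + 3 * T + 4 * P)) := by
    refine hdrift.trans ?_
    calc η * √(2 * H) * (dm * √(H / η) + ws)
        ≤ η * √(2 * H) * (dm * √(H / η) + (2 * (2 * D * √(H * sa))
          + (dm + 1) * √(H / η) * l)) := by gcongr
      _ = (√(2 * H) * √(H / η) * η) * (dm + (dm + 1) * l)
          + 4 * (η * D) * (√(2 * H) * √(H * sa)) := by ring
      _ ≤ (2 * H) * (dm + (dm + 1) * l) + 4 * (η * D) * (2 * H * √sa) := by gcongr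
      _ = H * (2 * dm + 2 * ((dm + 1) * l) + 8 * (η * √sa * D)) := by ring
      _ ≤ _ := mul_le_mul_of_nonneg_left (by linarith) hH.le
  have hX' : η / 2 * X ≤ H * (1 / 2 + P + 2 * P + 2 * Q + (3 * Q + 3 * T + 4 * P)) := by
    calc η / 2 * X ≤ η / 2 * (H / η + (2 * (K * (H * sa)) + H / η * l)
      + 2 * (2 * (D * H) + H * ((dm + 1) * (1 / η)) * l)) := by gcongr
      _ = H * (1 / 2 + η * (sa * K) + l / 2 + 2 * (η * D) + (dm + 1) * l) := by
          field_simp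
          ring
      _ ≤ _ := mul_le_mul_of_nonneg_left (by linarith) hH.le
  have e1 : H / η = H * (1 / η) := by ring
  have e2 : η / H * H ^ 2 / 2 * K + l / (η / H) = H * (η * K / 2 + l / η) := by
    field_simp
  have e3 : H * lsa / η = H * (lsa / η) := by ring
  have e4 : H * ((l + L) / (2 * η)) = H * ((l / η + L / η) / 2) := by
    field_simp
  have e5 : K * (η * (H * sa)) = H * (η * (sa * K)) := by ring
  rw [e1, e2, e3, e4, e5]
  have hfin : H * (1 + 1 / η + 2 * (2 * (3 * Q + 3 * T) + 8 * Q + 2 * (3 * Q + 3 * T + 4 * P))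
      + η * (sa * K) + (η * K / 2 + l / η) + lsa / η
      + (1 / 2 + P + 2 * P + 2 * Q + (3 * Q + 3 * T + 4 * P)) + (l / η + L / η) / 2)
      ≤ H * (100 * (P + Q + T)) := by
    gcongr
    linarith
  linarith

lemma sqrt_div_mul_self {y L : ℝ} (hy : 0 < y) : √(L / y) * y = √(y * L) := by
  rw [show y * L = (L / y) * y ^ 2 by field_simp, Real.sqrt_mul' _ (sq_nonneg y),
    Real.sqrt_sq hy.le]

lemma div_sqrt_div {y L : ℝ} (hy : 0 < y) (hL : 0 < L) : L / √(L / y) = √(y * L) := by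
  have h : 0 < √(L / y) := Real.sqrt_pos.2 (by positivity)
  rw [div_eq_iff h.ne', ← Real.sqrt_mul (by positivity),
    show y * L * (L / y) = L ^ 2 by field_simp, Real.sqrt_sq hL.le]

lemma sqrt_sqrt_mul {x D L : ℝ} (hx : 0 ≤ x) :
    √(√x * D * L) = x ^ (1 / 4 : ℝ) * √(D * L) := by
  rw [mul_assoc, Real.sqrt_mul (Real.sqrt_nonneg x), Real.sqrt_eq_rpow, Real.sqrt_eq_rpow,
    ← Real.rpow_mul hx]
  norm_num

lemma rate_pos {H S A K D δ : ℝ} (hH : 1 ≤ H) (hS : 1 ≤ S) (hA : 1 ≤ A) (hK : 1 ≤ K) (hD : 0 ≤ D)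
    (hL : 0 < Real.log (H * S * A / δ)) : 0 < rate H S A K D δ := by
  unfold rate
  split_ifs with h
  · exact Real.sqrt_pos.2 (by positivity)
  · have : 0 < D := lt_of_le_of_ne hD (Ne.symm h)
    exact lt_min (Real.sqrt_pos.2 (by positivity)) (Real.sqrt_pos.2 (by positivity))

lemma rate_le {H S A K D δ : ℝ} :
    rate H S A K D δ ≤ √(Real.log (H * S * A / δ) / (S * A * K)) := by
  unfold rate
  split_ifs with h
  · exact le_rfl
  · exact min_le_left _ _

lemma rate_mul_delay_le {H S A K D δ : ℝ} (hH : 1 ≤ H) (hS : 1 ≤ S) (hA : 1 ≤ A) (hD : 0 ≤ D) :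
    rate H S A K D δ * √(S * A) * D ≤
      (H * S * A) ^ (1 / 4 : ℝ) * √(D * Real.log (H * S * A / δ)) := by
  rcases hD.eq_or_lt with rfl | hD
  · simp
  · have hy : 0 < √(H * S * A) * D := by positivity
    rw [← sqrt_sqrt_mul (by positivity), ← sqrt_div_mul_self hy, mul_assoc]
    have h1 : √(S * A) ≤ √(H * S * A) := Real.sqrt_le_sqrt (by
      rw [mul_assoc]; exact le_mul_of_one_le_left (by positivity) hH)
    have h2 : rate H S A K D δ ≤ √(Real.log (H * S * A / δ) / (√(H * S * A) * D)) := by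
      unfold rate
      rw [if_neg hD.ne']
      exact min_le_right _ _
    gcongr

/-- Dividing by the minimum gives the larger of two square roots, which is at most their sum. -/
lemma log_div_rate_le {H S A K D δ : ℝ} (hH : 1 ≤ H) (hS : 1 ≤ S) (hA : 1 ≤ A) (hK : 1 ≤ K)
    (hD : 0 ≤ D) (hL : 0 < Real.log (H * S * A / δ)) :
    Real.log (H * S * A / δ) / rate H S A K D δ ≤
      √(S * A * K * Real.log (H * S * A / δ))
        + (H * S * A) ^ (1 / 4 : ℝ) * √(D * Real.log (H * S * A / δ)) := by
  have hP : 0 ≤ √(S * A * K * Real.log (H * S * A / δ)) := Real.sqrt_nonneg _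
  have hQ : 0 ≤ (H * S * A) ^ (1 / 4 : ℝ) * √(D * Real.log (H * S * A / δ)) := by positivity
  have h1 := div_sqrt_div (y := S * A * K) (by positivity) hL
  unfold rate
  split_ifs with h
  · rw [h1]
    linarith
  · have hD' : 0 < D := lt_of_le_of_ne hD (Ne.symm h)
    have h2 := div_sqrt_div (y := √(H * S * A) * D) (by positivity) hL
    rw [sqrt_sqrt_mul (by positivity)] at h2
    rcases min_choice (√(Real.log (H * S * A / δ) / (S * A * K)))
      (√(Real.log (H * S * A / δ) / (√(H * S * A) * D))) with h3 | h3 <;> rw [h3]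
    · linarith
    · linarith

lemma log_five_le : Real.log 5 ≤ 3 * Real.log 2 := by
  rw [show (3 : ℝ) * Real.log 2 = Real.log (2 ^ 3) by rw [Real.log_pow]; norm_num]
  exact Real.log_le_log (by norm_num) (by norm_num)

/-- The constant `log 5` has to be absorbed. For `H ≥ 2` it is at most `3 log H`. For `H = 1` the
factor `log (H/δ)` may be arbitrarily small, and `d_max log 5` is charged to the `√D` term by means
of `d_max ≤ √D`. -/
lemma maxDelay_mul_log_le {H : ℕ} {δ dm D L : ℝ} {x : ℝ} (hH : 0 < H) (hδ : 0 < δ) (hδ1 : δ < 1)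
    (hdm : 0 ≤ dm) (hdmD : dm ≤ √D) (hL : Real.log 2 ≤ L) (hx : 1 ≤ x) :
    dm * Real.log (1 / (δ / 5)) ≤
      3 * (x ^ (1 / 4 : ℝ) * √(D * L)) + 3 * (√H * dm * Real.log (H / δ)) := by
  have hlog2 : 0 < Real.log 2 := Real.log_pos (by norm_num)
  have hl : Real.log (1 / (δ / 5)) = Real.log 5 + Real.log (1 / δ) := by
    rw [← Real.log_mul (by norm_num) (by positivity)]
    congr 1
    field_simp
  have hld : 0 < Real.log (1 / δ) := Real.log_pos (by rw [lt_div_iff₀ hδ]; linarith)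
  have hHd : Real.log (H / δ) = Real.log H + Real.log (1 / δ) := by
    rw [← Real.log_mul (by positivity) (by positivity)]
    congr 1
    ring
  have hQ : 0 ≤ x ^ (1 / 4 : ℝ) * √(D * L) := by positivity
  have h5 := log_five_le
  rw [hl, hHd]
  rcases Nat.lt_or_ge 1 H with h | h
  · have hH2 : (2 : ℝ) ≤ H := by exact_mod_cast h
    have h1 : Real.log 2 ≤ Real.log H := Real.log_le_log (by norm_num) hH2
    have h2 : 1 ≤ √(H : ℝ) := Real.one_le_sqrt.2 (by linarith)
    have h3 : dm * (Real.log 5 + Real.log (1 / δ)) ≤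
        dm * (3 * (Real.log H + Real.log (1 / δ))) := by gcongr; linarith
    have h4 : dm * (Real.log H + Real.log (1 / δ)) ≤
        √H * (dm * (Real.log H + Real.log (1 / δ))) :=
      le_mul_of_one_le_left (mul_nonneg hdm (by linarith)) h2
    linarith
  · have hH1 : H = 1 := by omega
    subst hH1
    have h1 : Real.log 2 ≤ √L := by
      refine Real.le_sqrt_of_sq_le (le_trans ?_ hL)
      have : Real.log 2 ≤ 1 := by linarith [Real.log_two_lt_d9]
      nlinarith
    have h2 : dm * Real.log 2 ≤ √(D * L) := by
      rw [Real.sqrt_mul' _ (hlog2.le.trans hL)]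
      gcongr
    have h3 : √(D * L) ≤ x ^ (1 / 4 : ℝ) * √(D * L) :=
      le_mul_of_one_le_left (Real.sqrt_nonneg _) (Real.one_le_rpow hx (by norm_num))
    have h4 : dm * Real.log 5 ≤ dm * (3 * Real.log 2) := by gcongr
    have h6 : 0 ≤ dm * Real.log (1 / δ) := by positivity
    simp only [Nat.cast_one, Real.log_one, Real.sqrt_one, one_mul, zero_add]
    linarith

/-- The numerical facts about the rate in the regime `2 ≤ A`, `L ≤ K`. -/
lemma rate_regime {H S A K D δ : ℝ} (hH : 1 ≤ H) (hS : 1 ≤ S) (hA : 2 ≤ A) (hK : 1 ≤ K)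
    (hδ : 0 < δ) (hδ1 : δ < 1) (hLK : Real.log (H * S * A / δ) ≤ K) :
    Real.log 2 ≤ Real.log (H * S * A / δ) ∧ Real.log (S * A) ≤ Real.log (H * S * A / δ) ∧
      Real.log (1 / (δ / 5)) ≤ 4 * Real.log (H * S * A / δ) ∧
      rate H S A K D δ ≤ 1 ∧
      rate H S A K D δ * (S * A * K) ≤ √(S * A * K * Real.log (H * S * A / δ)) ∧
      Real.log (H * S * A / δ) ≤ √(S * A * K * Real.log (H * S * A / δ)) := by
  have hSA : 2 ≤ S * A := by nlinarith
  have hHSA : S * A ≤ H * S * A := by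
    rw [mul_assoc]
    exact le_mul_of_one_le_left (by positivity) hH
  have hdiv : H * S * A ≤ H * S * A / δ := by
    rw [le_div_iff₀ hδ]
    exact mul_le_of_le_one_right (by positivity) hδ1.le
  have hL2 : Real.log 2 ≤ Real.log (H * S * A / δ) :=
    Real.log_le_log (by norm_num) (by linarith)
  have hl : Real.log (1 / (δ / 5)) = Real.log 5 + Real.log (1 / δ) := by
    rw [← Real.log_mul (by norm_num) (by positivity)]
    congr 1
    field_simp
  have hld : Real.log (1 / δ) ≤ Real.log (H * S * A / δ) :=
    Real.log_le_log (by positivity) (by gcongr; linarith)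
  have hL0 : 0 < Real.log (H * S * A / δ) := (Real.log_pos (by norm_num)).trans_le hL2
  have hSAK : 0 < S * A * K := by positivity
  have hKle : K ≤ S * A * K := le_mul_of_one_le_left (by linarith) (by linarith)
  refine ⟨hL2, Real.log_le_log (by positivity) (by linarith), ?_, ?_, ?_, ?_⟩
  · linarith [log_five_le]
  · refine rate_le.trans (Real.sqrt_le_one.2 ?_)
    rw [div_le_one hSAK]
    linarith
  · rw [← sqrt_div_mul_self hSAK]
    exact mul_le_mul_of_nonneg_right rate_le hSAK.le
  · refine Real.le_sqrt_of_sq_le ?_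
    rw [sq]
    exact mul_le_mul_of_nonneg_right (by linarith) hL0.le

lemma one_le_log_inv {δ : ℝ} (hδ : 0 < δ) (hδ1 : δ < 1) : 1 ≤ Real.log (1 / (δ / 5)) := by
  rw [Real.le_log_iff_exp_le (by positivity), one_div_div, le_div_iff₀ hδ]
  nlinarith [Real.exp_one_lt_d9, Real.exp_pos 1]

/-! ### The concentration event and the main regime. -/

section Main

lemma policy_subsingleton {S A : Type*} [Fintype A] {H : ℕ} (hA : Fintype.card A = 1) : Subsingleton (Policy S A H) := by
  have hsub : Subsingleton A := Fintype.card_le_one_iff_subsingleton.1 hA.le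
  have h1 : ∀ (p : PMF A) (a : A), p a = 1 := by
    intro p a
    have := p.tsum_coe
    rwa [tsum_eq_single a fun b hb => absurd (Subsingleton.elim b a) hb] at this
  exact ⟨fun π π' => funext fun h => funext fun s => PMF.ext fun a => by rw [h1, h1]⟩

variable {S A : Type*} [Fintype S] [Fintype A]

lemma regret_le_of_forall [Nonempty A] {H : ℕ} (M : MDP S A H) (c : ℕ → Table S A H) (K : ℕ)
    (π : ℕ → Policy S A H) {B : ℝ}
    (h : ∀ π' : Policy S A H, ∑ k : Fin K, value M (π k) (c k) - ∑ k : Fin K, value M π' (c k)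
      ≤ B) : regret M c K π ≤ B := by
  have : Nonempty (Policy S A H) := ⟨fun _ _ => PMF.uniformOfFintype A⟩
  have h1 : ∑ k ∈ Finset.range K, value M (π k) (c k) - B ≤
      ⨅ π' : Policy S A H, ∑ k ∈ Finset.range K, value M π' (c k) := by
    refine le_ciInf fun π' => ?_
    have := h π'
    rw [Finset.sum_range, Finset.sum_range]
    linarith
  unfold regret
  linarith

variable [Nonempty A] {H K : ℕ}

/-- The regret bound on the event where the estimators concentrate, in the main regime
`log 2 ≤ L ≤ K`. -/
lemma regret_le_of_concentration (hH : 0 < H) (hK : 0 < K) (M : MDP S A H) (c : ℕ → Table S A H)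
    (d : ℕ → ℕ) {δ η : ℝ}
    (hc : ∀ k < K, ∀ h s a, 0 ≤ c k h s a ∧ c k h s a ≤ 1)
    (hd : (maxDelay d K : ℝ) ≤ √(totalDelay d K : ℝ)) (hδ : 0 < δ) (hδ1 : δ < 1)
    (hη : η = rate H (Fintype.card S) (Fintype.card A) K (totalDelay d K) δ)
    (hA2 : 2 ≤ Fintype.card A)
    (hLK : Real.log (H * Fintype.card S * Fintype.card A / δ) ≤ K)
    (ω : Fin K → Traj S A H)
    (good₁ : ∑ j, ∑ x, lateEst M c d η η ω j x ≤
      2 * (K * (H * Fintype.card S * Fintype.card A)) + H / η * Real.log (1 / (δ / 5)))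
    (good₂ : ∑ j : Fin K, (outstanding d j : ℝ) * √(∑ x, lateEst M c d η η ω j x) ≤
      2 * ∑ j : Fin K, (outstanding d j : ℝ) * √(H * Fintype.card S * Fintype.card A)
        + (maxDelay d K + 1) * √(H / η) * Real.log (1 / (δ / 5)))
    (good₃ : ∑ j, ∑ x, tieWeight M c d η η ω j x * lateEst M c d η η ω j x ≤
      2 * ∑ j : Fin K, (tieCount d j : ℝ) * H
        + H * ((maxDelay d K + 1) * (1 / η)) * Real.log (1 / (δ / 5)))
    (good₄ : ∑ j : Fin K, (∑ x, flat (occupancy M (policy M c d η η ω j)) x *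
            (flat (iterate M c d η η ω (j + d j)) x * lateFactor M c d η η ω j x)
          - ∑ x, visit (ω j) x *
            (flat (iterate M c d η η ω (j + d j)) x * lateFactor M c d η η ω j x)) ≤
      η / H * (H : ℝ) ^ 2 / 2 * K + Real.log (1 / (δ / 5)) / (η / H))
    (good₅ : ∀ x, ∑ j : Fin K, (lateEst M c d η η ω j x - flat (c j) x) ≤
      Real.log (1 / (δ / 5 / (H * Fintype.card S * Fintype.card A))) / (2 * η)) :
    regret M c K (policy M c d η η ω) ≤
      100 * bound H (Fintype.card S) (Fintype.card A) K (totalDelay d K) (maxDelay d K) δ := by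
  have : Nonempty S := ⟨M.init⟩
  have hH1 : (1 : ℝ) ≤ H := by exact_mod_cast hH
  have hK1 : (1 : ℝ) ≤ K := by exact_mod_cast hK
  have hS1 : (1 : ℝ) ≤ Fintype.card S := by exact_mod_cast Fintype.card_pos (α := S)
  have hA1 : (2 : ℝ) ≤ Fintype.card A := by exact_mod_cast hA2
  have hwsum : ∑ j : Fin K, (outstanding d j : ℝ) ≤ 2 * totalDelay d K := by
    exact_mod_cast sum_outstanding_le (K := K) d
  have htsum : ∑ j : Fin K, (tieCount d j : ℝ) ≤ totalDelay d K := by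
    exact_mod_cast sum_tieCount_le (K := K) d
  -- Fictitious steps after the last episode process the late feedback; by `K + d_max` everything
  -- has arrived.
  have hN : ∀ j : Fin K, (j : ℕ) + d j < K + maxDelay d K := fun j => by
    have := le_maxDelay d j
    omega
  have hD0 : (0 : ℝ) ≤ totalDelay d K := Nat.cast_nonneg _
  have hdm0 : (0 : ℝ) ≤ maxDelay d K := Nat.cast_nonneg _
  have hdrift := fun h : 0 < η => sum_drift_le M c d h h hK hc ω
  have hloc := fun h : 0 < η => sum_localNorm_le M c d (η := η) h hK hc ω hN
  have hdec := fun (h : 0 < η) (π' : Policy S A H) (upper : ℝ) =>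
    regret_decomposition M c d h h hK hc ω hN π' good₄ (upper := upper)
  generalize (totalDelay d K : ℝ) = D at *
  generalize (maxDelay d K : ℝ) = dm at *
  generalize (Fintype.card S : ℝ) = s at *
  generalize (Fintype.card A : ℝ) = a at *
  obtain ⟨hL2, hlsa, hl, hη1, hηK, hLP⟩ := rate_regime (D := D) hH1 hS1 hA1 hK1 hδ hδ1 hLK
  have hl1 := one_le_log_inv hδ hδ1
  have hlog2 : 0.69 < Real.log 2 := by linarith [Real.log_two_gt_d9]
  have hL0 : 0 < Real.log (H * s * a / δ) := by linarith
  have hη0 : 0 < η := by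
    rw [hη]; exact rate_pos hH1 hS1 (by linarith) hK1 hD0 hL0
  have hηD := rate_mul_delay_le (K := (K : ℝ)) (δ := δ) hH1 hS1 (by linarith : 1 ≤ a) hD0
  have hLη := log_div_rate_le (δ := δ) hH1 hS1 (by linarith : 1 ≤ a) hK1 hD0 hL0
  rw [← hη] at hηD hLη hη1 hηK
  have hHsa : 1 ≤ H * s * a :=
    one_le_mul_of_one_le_of_one_le (one_le_mul_of_one_le_of_one_le hH1 hS1) (by linarith)
  have hdml := maxDelay_mul_log_le hH hδ hδ1 hdm0 hd hL2 hHsa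
  have hT0 : 0 ≤ √H * dm * Real.log (H / δ) := by
    have : 0 ≤ Real.log (H / δ) := Real.log_nonneg (by rw [le_div_iff₀ hδ]; linarith)
    positivity
  -- The union over the `HSA` coordinates costs one more `L`.
  have hlog5 : Real.log (1 / (δ / 5 / (H * s * a))) ≤
      Real.log (1 / (δ / 5)) + Real.log (H * s * a / δ) := by
    rw [← Real.log_mul (by positivity) (by positivity)]
    refine Real.log_le_log (by positivity) ?_
    rw [show 1 / (δ / 5) * (H * s * a / δ) = 1 / (δ / 5 / (H * s * a)) / δ by field_simp,
      le_div_iff₀ hδ]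
    exact mul_le_of_le_one_right (by positivity) hδ1.le
  generalize hLdef : Real.log (H * s * a / δ) = L at *
  generalize Real.log (1 / (δ / 5)) = l at *
  have hupper : ∀ x, ∑ j : Fin K, (lateEst M c d η η ω j x - flat (c j) x) ≤
      (l + L) / (2 * η) := by
    intro x
    refine (good₅ x).trans ?_
    gcongr
  have hws : ∑ j : Fin K, (outstanding d j : ℝ) * √(∑ x, lateEst M c d η η ω j x) ≤
      2 * (2 * D * √(H * (s * a))) + (dm + 1) * √(H / η) * l := by
    refine good₂.trans ?_
    rw [← Finset.sum_mul, ← mul_assoc (H : ℝ)]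
    gcongr
  have hX : ∑ m ∈ Finset.range (K + maxDelay d K), localNorm M c d η η ω m ≤
      H / η + (2 * (K * (H * (s * a))) + H / η * l)
      + 2 * (2 * (D * H) + H * ((dm + 1) * (1 / η)) * l) := by
    refine (hloc hη0).trans ?_
    rw [← Finset.sum_mul] at good₃
    rw [← mul_assoc (H : ℝ) s a]
    have : (∑ j : Fin K, (tieCount d j : ℝ)) * H ≤ D * H := by gcongr
    linarith
  refine regret_le_of_forall M c K _ fun π' => ?_
  refine (hdec hη0 π' _ hupper).trans ?_
  have key := total_bound_le (lsa := Real.log (s * a)) (K := K) (P := √(s * a * K * L))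
    (by linarith : (0 : ℝ) < H) hη0 hη1 hD0 hdm0 (by nlinarith : 1 ≤ s * a) (by linarith : 1 / 2 ≤ L)
    hl1 hl hlsa (by linarith) hT0 hηK hLη hηD hLP hdml
    hws (hdrift hη0) hX
  have hb : bound H s a K D dm δ = H * √(s * a * K * L)
      + (H * s * a) ^ (1 / 4 : ℝ) * √(D * L) * H + H * (√H * dm * Real.log (H / δ)) := by
    have h32 : (H : ℝ) ^ (3 / 2 : ℝ) = H * √H := by
      rw [Real.sqrt_eq_rpow, show (3 / 2 : ℝ) = 1 + 1 / 2 by norm_num,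
        Real.rpow_add (by linarith), Real.rpow_one]
    rw [bound, h32, hLdef]
    ring
  rw [hb]
  simpa only [mul_assoc] using key

/-- The regret bound in the main regime `2 ≤ A`, `L ≤ K`. -/
lemma regret_bound_of_log_le (hH : 0 < H) (hK : 0 < K) (M : MDP S A H) (c : ℕ → Table S A H)
    (d : ℕ → ℕ) {δ η : ℝ} (hc : ∀ k < K, ∀ h s a, 0 ≤ c k h s a ∧ c k h s a ≤ 1)
    (hd : (maxDelay d K : ℝ) ≤ √(totalDelay d K : ℝ)) (hδ : 0 < δ) (hδ1 : δ < 1)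
    (hη : η = rate H (Fintype.card S) (Fintype.card A) K (totalDelay d K) δ)
    (hA2 : 2 ≤ Fintype.card A)
    (hLK : Real.log (H * Fintype.card S * Fintype.card A / δ) ≤ K) :
    ENNReal.ofReal (1 - δ) ≤
      (run M c d η η K).toOuterMeasure
        {ω | regret M c K (policy M c d η η ω) ≤
          100 * bound H (Fintype.card S) (Fintype.card A) K (totalDelay d K)
            (maxDelay d K) δ} := by
  classical
  have : Nonempty S := ⟨M.init⟩
  have hH1 : (1 : ℝ) ≤ H := by exact_mod_cast hH
  have hK1 : (1 : ℝ) ≤ K := by exact_mod_cast hK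
  have hS1 : (1 : ℝ) ≤ Fintype.card S := by exact_mod_cast Fintype.card_pos (α := S)
  have hA1 : (1 : ℝ) ≤ Fintype.card A := by exact_mod_cast Fintype.card_pos (α := A)
  have hη0 : 0 < η := by
    rw [hη]
    refine rate_pos hH1 hS1 hA1 hK1 (Nat.cast_nonneg _) (Real.log_pos ?_)
    rw [lt_div_iff₀ hδ, one_mul]
    exact hδ1.trans_le (one_le_mul_of_one_le_of_one_le
      (one_le_mul_of_one_le_of_one_le hH1 hS1) hA1)
  have hε : 0 < δ / 5 := by positivity
  have hε' : 0 < δ / 5 / (H * Fintype.card S * Fintype.card A) := by positivity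
  -- The added one keeps the range positive when all delays vanish.
  have hW : (0 : ℝ) < (maxDelay d K : ℝ) + 1 := by positivity
  have hwW : ∀ j : Fin K, (outstanding d j : ℝ) ≤ (maxDelay d K : ℝ) + 1 := fun j => by
    have : (outstanding d j : ℝ) ≤ (maxDelay d K : ℝ) := by
      exact_mod_cast outstanding_le d j
    linarith
  have hNW : ∀ j : Fin K, (tieCount d j : ℝ) ≤ (maxDelay d K : ℝ) + 1 := fun j => by
    have : (tieCount d j : ℝ) ≤ (maxDelay d K : ℝ) := by
      exact_mod_cast tieCount_le d j
    linarith
  -- With `lam = η / H` and range `H` the lower tail becomes `H (ηK/2 + log (5/δ)/η)`, of the same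
  -- form as the mirror descent terms.
  have hlam : 0 < η / H := by positivity
  obtain ⟨F₁, hF₁, good₁⟩ := exists_bad_event (sum_lateEst_tail M c d η hη0 hH hc hε)
  obtain ⟨F₂, hF₂, good₂⟩ := exists_bad_event (sum_sqrt_lateEst_tail M c d η hη0 hH hc
    (fun j => (outstanding d j : ℝ)) (fun j => Nat.cast_nonneg _) hW hwW hε)
  obtain ⟨F₃, hF₃, good₃⟩ := exists_bad_event (sum_tie_tail M c d η hη0 hH hc hW hNW hε)
  obtain ⟨F₄, hF₄, good₄⟩ := exists_bad_event
    (arrival_lateEst_lower_tail M c d η hη0 hc hlam hε)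
  choose F₅ hF₅ good₅ using fun x => exists_bad_event (lateEst_upper_tail M c d η hη0 hc x hε')
  -- Four events of probability `δ/5`, and one of probability `δ/(5HSA)` for each coordinate.
  refine le_toOuterMeasure_of_bad_events (ι := Fin 4 ⊕ (Fin H × S × A)) _ _
    (Sum.elim ![F₁, F₂, F₃, F₄] F₅) (δ := δ) ?_ fun ω hω => ?_
  · rw [Fintype.sum_sum_type, Fin.sum_univ_four]
    refine (add_le_add (add_le_add (add_le_add (add_le_add hF₁ hF₂) hF₃) hF₄)
      (Finset.sum_le_sum fun x _ => hF₅ x)).trans (le_of_eq ?_)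
    simp only [Finset.sum_const, Finset.card_univ, Fintype.card_prod, Fintype.card_fin,
        nsmul_eq_mul, Nat.cast_mul]
    field_simp
    ring
  replace good₁ := good₁ ω (hω (Sum.inl 0))
  replace good₂ := good₂ ω (hω (Sum.inl 1))
  replace good₃ := good₃ ω (hω (Sum.inl 2))
  replace good₄ := good₄ ω (hω (Sum.inl 3))
  replace good₅ := fun x => good₅ x ω (hω (Sum.inr x))
  exact regret_le_of_concentration hH hK M c d hc hd hδ hδ1 hη hA2 hLK ω good₁ good₂ good₃ good₄
    good₅

end Main

end

end DelayedOREPS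

open DelayedOREPS in
theorem theorem3 :
    ∃ C : ℝ, 0 < C ∧
      ∀ (S A : Type*) [Fintype S] [Fintype A] [Nonempty A] (H K : ℕ), 0 < H → 0 < K →
      ∀ (M : MDP S A H) (c : ℕ → Table S A H) (d : ℕ → ℕ) (δ η : ℝ),
        (∀ k < K, ∀ h s a, 0 ≤ c k h s a ∧ c k h s a ≤ 1) →
        (maxDelay d K : ℝ) ≤ √(totalDelay d K : ℝ) →
        0 < δ → δ < 1 →
        η = rate H (Fintype.card S) (Fintype.card A) K (totalDelay d K) δ →
        ENNReal.ofReal (1 - δ) ≤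
          (run M c d η η K).toOuterMeasure
            {ω | regret M c K (policy M c d η η ω) ≤
              C * bound H (Fintype.card S) (Fintype.card A) K (totalDelay d K) (maxDelay d K) δ}
      := by
  refine ⟨100, by norm_num, ?_⟩
  intro S A _ _ _ H K hH hK M c d δ η hc hd hδ hδ1 hη
  have : Nonempty S := ⟨M.init⟩
  have hH1 : (1 : ℝ) ≤ H := by exact_mod_cast hH
  have hS1 : (1 : ℝ) ≤ Fintype.card S := by exact_mod_cast Fintype.card_pos (α := S)
  have hA1 : (1 : ℝ) ≤ Fintype.card A := by exact_mod_cast Fintype.card_pos (α := A)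
  have hlogH : 0 ≤ Real.log (H / δ) := Real.log_nonneg (by rw [le_div_iff₀ hδ]; linarith)
  have hrest : 0 ≤ (H * Fintype.card S * Fintype.card A : ℝ) ^ (1 / 4 : ℝ) * H *
      √(totalDelay d K * Real.log (H * Fintype.card S * Fintype.card A / δ))
      + (H : ℝ) ^ (3 / 2 : ℝ) * maxDelay d K * Real.log (H / δ) := by positivity
  have hall : (∀ ω, regret M c K (policy M c d η η ω) ≤
      100 * bound H (Fintype.card S) (Fintype.card A) K (totalDelay d K) (maxDelay d K) δ) →
      ENNReal.ofReal (1 - δ) ≤ (run M c d η η K).toOuterMeasure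
        {ω | regret M c K (policy M c d η η ω) ≤ 100 * bound H (Fintype.card S)
          (Fintype.card A) K (totalDelay d K) (maxDelay d K) δ} := fun h =>
    le_toOuterMeasure_of_bad_events (ι := Empty) _ _ (fun i => i.elim) (by simpa using hδ.le)
      fun ω _ => h ω
  rcases Nat.lt_or_ge 1 (Fintype.card A) with hA2 | hA2
  · rcases le_or_gt (Real.log (H * Fintype.card S * Fintype.card A / δ)) K with hLK | hLK
    · exact regret_bound_of_log_le hH hK M c d hc hd hδ hδ1 hη hA2 hLK
    -- For `K < L` the trivial bound suffices, since `K² ≤ SAK L`.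
    · refine hall fun ω => regret_le_of_forall M c K _ fun π' => ?_
      have h1 : ∑ k : Fin K, value M (policy M c d η η ω k) (c k) ≤ K * H := by
        refine (Finset.sum_le_sum fun (k : Fin K) _ =>
          value_le_horizon M c (hc k k.2) _).trans ?_
        simp
      have h2 : 0 ≤ ∑ k : Fin K, value M π' (c k) :=
        Finset.sum_nonneg fun (k : Fin K) _ => value_nonneg M c (hc k k.2) π'
      have h3 : (K : ℝ) ≤ √(Fintype.card S * Fintype.card A * K *
          Real.log (H * Fintype.card S * Fintype.card A / δ)) := by
        refine Real.le_sqrt_of_sq_le ?_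
        rw [sq]
        gcongr
        exact le_mul_of_one_le_left (Nat.cast_nonneg _) (one_le_mul_of_one_le_of_one_le hS1 hA1)
      have h4 : (K : ℝ) * H ≤ H * √(Fintype.card S * Fintype.card A * K *
          Real.log (H * Fintype.card S * Fintype.card A / δ)) := by
        rw [mul_comm]
        gcongr
      have h5 : (0 : ℝ) ≤ K * H := by positivity
      unfold bound
      linarith
  -- With a single action, where `L` may be close to zero, there is only one policy and the regret
  -- vanishes.
  · have hsub : Subsingleton (Policy S A H) :=
      policy_subsingleton (le_antisymm hA2 Fintype.card_pos)
    refine hall fun ω => regret_le_of_forall M c K _ fun π' => ?_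
    rw [Finset.sum_congr rfl fun k _ => by
      rw [Subsingleton.elim (policy M c d η η ω (k : Fin K)) π'], sub_self]
    unfold bound
    have : 0 ≤ H * √(Fintype.card S * Fintype.card A * K *
          Real.log (H * Fintype.card S * Fintype.card A / δ)) := by positivity
    linarith
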